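/- Let $(\xi_i)_{i\ge 1}$ be a stationary Gaussian process with mean $0$, variance $1$ and autocovariance function $\rho(k)\sim k^{-D}L(k)$ as $k\to\infty$, where $L$ is slowly varying at infinity. Let $G:\mathbb{R}\to\mathbb{R}$ be measurable and assume that $G(\xi_i)$ has a continuous distribution function $F$. Let $m$ be the Hermite rank of the class of functions $1_{\{G(\xi_i)\le x\}}-F(x)$, $x\in\mathbb{R}$, i.e. $m=\min\{q\ge 1: J_q(x)\ne 0 \text{ for some } x\in\mathbb{R}\}$ with $J_q(x)=\mathrm{E}\big(H_q(\xi_i)1_{\{G(\xi_i)\le x\}}\big)$ and $H_q$ the $q$-th (probabilists') Hermite polynomial, and assume $0<D<\frac1m$. Let $0<\tau_1<\tau_2<1$, $\tau\in[\tau_1,\tau_2]$, $\mu\in\mathbb{R}$ and $\Delta\neq 0$ be fixed, and for each $n$ let $k^*=\lfloor n\tau\rfloor$ and $$X_i=\begin{cases}\mu+G(\xi_i), & i=1,\ldots,k^*,\\ \mu+\Delta+G(\xi_i), & i=k^*+1,\ldots,n.\end{cases}$$ With the ranks $R_i=\sum_{j=1}^n 1_{\{X_j\le X_i\}}$, put $\bar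 R_{j,k}=\frac{1}{k-j+1}\sum_{t=j}^k R_t$, $S_t(j,k)=\sum_{h=j}^t(R_h-\bar R_{j,k})$, $$G_n(k)=\frac{\left|\sum_{i=1}^kR_i-\frac kn\sum_{i=1}^nR_i\right|}{\left\{\frac1n\sum_{t=1}^kS_t^2(1,k)+\frac1n\sum_{t=k+1}^nS_t^2(k+1,n)\right\}^{1/2}},\qquad T_n(\tau_1,\tau_2)=\max_{\lfloor n\tau_1\rfloor\le k\le\lfloor n\tau_2\rfloor}G_n(k).$$ Then $T_n(\tau_1,\tau_2)$ diverges in probability to $\infty$ as $n\to\infty$: for every $M\in\mathbb{R}$, $P\big(T_n(\tau_1,\tau_2)>M\big)\to 1$. -/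

import Mathlib

open MeasureTheory ProbabilityTheory Filter Topology Asymptotics

noncomputable section

namespace SelfNormWilcoxon

/-! ### The self-normalized Wilcoxon statistic of a sample `x 1, …, x n` -/

/-- The rank `R_i = ∑_{j=1}^n 1{x_j ≤ x_i}` of the `i`-th observation. -/
def rankStat (x : ℕ → ℝ) (n i : ℕ) : ℝ :=
  ∑ j ∈ Finset.Icc 1 n, if x j ≤ x i then (1 : ℝ) else 0

/-- The mean `(k - j + 1)⁻¹ ∑_{t=j}^k R_t` of the ranks of the observations `j, …, k`. -/
def meanRank (x : ℕ → ℝ) (n j k : ℕ) : ℝ :=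
  (1 / ((k : ℝ) - (j : ℝ) + 1)) * ∑ t ∈ Finset.Icc j k, rankStat x n t

/-- The partial sum `S_t(j, k) = ∑_{h=j}^t (R_h - R̄_{j,k})` of the centred ranks. -/
def partialSum (x : ℕ → ℝ) (n j k t : ℕ) : ℝ :=
  ∑ h ∈ Finset.Icc j t, (rankStat x n h - meanRank x n j k)

/-- The numerator `|∑_{i=1}^k R_i - (k/n) ∑_{i=1}^n R_i|`. -/
def cusumRank (x : ℕ → ℝ) (n k : ℕ) : ℝ :=
  |∑ i ∈ Finset.Icc 1 k, rankStat x n i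
    - ((k : ℝ) / (n : ℝ)) * ∑ i ∈ Finset.Icc 1 n, rankStat x n i|

/-- The self-normalizer
`{n⁻¹ ∑_{t=1}^k S_t(1,k)² + n⁻¹ ∑_{t=k+1}^n S_t(k+1,n)²}^{1/2}`. -/
def selfNormalizer (x : ℕ → ℝ) (n k : ℕ) : ℝ :=
  Real.sqrt ((1 / (n : ℝ)) * ∑ t ∈ Finset.Icc 1 k, partialSum x n 1 k t ^ 2
    + (1 / (n : ℝ)) * ∑ t ∈ Finset.Icc (k + 1) n, partialSum x n (k + 1) n t ^ 2)

/-- The self-normalized two-sample statistic `G_n(k)`. -/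
def statG (x : ℕ → ℝ) (n k : ℕ) : ℝ :=
  cusumRank x n k / selfNormalizer x n k

/-- The test statistic `T_n(τ₁, τ₂) = sup_{⌊nτ₁⌋ ≤ k ≤ ⌊nτ₂⌋} G_n(k)`, a supremum over finitely many
integers `k`. -/
def statT (x : ℕ → ℝ) (n : ℕ) (τ₁ τ₂ : ℝ) : ℝ :=
  ⨆ k : Set.Icc ⌊(n : ℝ) * τ₁⌋₊ ⌊(n : ℝ) * τ₂⌋₊, statG x n k

/-! ### The model -/

/-- `L` is slowly varying at infinity: measurable, eventually positive, and
`L (c x) / L x → 1` as `x → ∞`, for every `c > 0`. -/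
structure IsSlowlyVarying (L : ℝ → ℝ) : Prop where
  measurable : Measurable L
  eventually_pos : ∀ᶠ x in atTop, 0 < L x
  tendsto_ratio : ∀ c : ℝ, 0 < c → Tendsto (fun x => L (c * x) / L x) atTop (𝓝 1)

/-- `(ξ_i)_{i ≥ 1}` is a stationary Gaussian process with mean `0`, variance `1` and autocovariance
function `ρ(k) ∼ k^{-D} L(k)` for some slowly varying function `L`. The value `ξ 0` plays no role.
For a Gaussian process stationarity means that the mean and the autocovariances do not depend on
the time `i`. -/
structure IsLRDGaussian {Ω : Type*} [MeasurableSpace Ω] (P : Measure Ω) (ξ : ℕ → Ω → ℝ) (D : ℝ) :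
    Prop where
  gaussian : IsGaussianProcess (fun i : Set.Ici (1 : ℕ) => ξ i) P
  mean_zero : ∀ i, 1 ≤ i → ∫ ω, ξ i ω ∂P = 0
  variance_one : ∀ i, 1 ≤ i → Var[ξ i; P] = 1
  stationary : ∀ i, 1 ≤ i → ∀ k, cov[ξ i, ξ (i + k); P] = cov[ξ 1, ξ (1 + k); P]
  long_range : ∃ L : ℝ → ℝ, IsSlowlyVarying L ∧
    (fun k : ℕ => cov[ξ 1, ξ (1 + k); P]) ~[atTop] (fun k : ℕ => (k : ℝ) ^ (-D) * L k)

/-- The Hermite coefficient `J_q(x) = E(H_q(ζ) 1{G(ζ) ≤ x})`, with `H_q` the probabilists' Hermite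
polynomial of order `q`. -/
def hermiteCoeff {Ω : Type*} [MeasurableSpace Ω] (P : Measure Ω) (ζ : Ω → ℝ) (G : ℝ → ℝ)
    (q : ℕ) (x : ℝ) : ℝ :=
  ∫ ω, Polynomial.aeval (ζ ω) (Polynomial.hermite q) * (if G (ζ ω) ≤ x then (1 : ℝ) else 0) ∂P

/-- `m` is the Hermite rank of the class of functions `1{G(ζ) ≤ x} - F(x)`, `x ∈ ℝ`:
`m = min {q ≥ 1 : J_q(x) ≠ 0 for some x}`. -/
def IsHermiteRank {Ω : Type*} [MeasurableSpace Ω] (P : Measure Ω) (ζ : Ω → ℝ) (G : ℝ → ℝ)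
    (m : ℕ) : Prop :=
  IsLeast {q : ℕ | 1 ≤ q ∧ ∃ x : ℝ, hermiteCoeff P ζ G q x ≠ 0} m

/-- The observations `X_1, …, X_n` (sample size `n`) with a level shift of height `Δ` after
`k* = ⌊nτ⌋`: `X_i = μ + G(ξ_i)` for `i ≤ k*` and `X_i = μ + Δ + G(ξ_i)` for `i > k*`. -/
def shiftModel {Ω : Type*} (ξ : ℕ → Ω → ℝ) (G : ℝ → ℝ) (μ Δ τ : ℝ) (n : ℕ) (ω : Ω) (i : ℕ) : ℝ :=
  if i ≤ ⌊(n : ℝ) * τ⌋₊ then μ + G (ξ i ω) else μ + Δ + G (ξ i ω)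

end SelfNormWilcoxon

end

/-! The maximum is bounded below by `statG` at the true change point `k = ⌊nτ⌋`. There the numerator
is of order `n ^ 2`, while the self-normalizer is at most an arbitrarily small multiple of `n ^ 2`,
because it centres the two segments separately and so does not see the shift. Only a law of large
numbers is needed: with probability tending to one, all counts `#{i ≤ t : G(ξ i) ≤ x}`, `t ≤ n`, lie
within `εn` of `t F(x)` (`tendsto_measure_empirical_deviation`).

The probabilistic half: slow variation gives vanishing autocovariances, hence vanishing covariances
of bounded functions of the `ξ i`. The partial sums of indicators then have variance `o(n ^ 2)`.
Chebyshev's inequality and a finite grid in time and level, using continuity of `F`, give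
uniformity.

The rest is deterministic. Write `p(δ)` for `shiftProb ν δ`. On the uniform event the ranks average
about `α = k p(0) + (n - k) p(-Δ)` before the change and `β = k p(Δ) + (n - k) p(0)` after it.
Strict monotonicity of `p` at `0` makes `|α - β|` at least `n d` for some `d > 0`
(`exists_shiftProb_gap`), so the numerator is at least `k (n - k) d - 9 ε n ^ 2`
(`IsShifted.le_cusumRank`) and the self-normalizer at most `10 ε n ^ 2`
(`IsShifted.selfNormalizer_le`). Taking `ε` small makes the ratio exceed any `M`. -/

/-! ### Slowly varying functions and decay of the autocovariance -/

/-- The uniform convergence theorem for slowly varying functions, in additive form. -/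
theorem exists_forall_abs_add_sub_le {h : ℝ → ℝ} (hh : Measurable h)
    (H : ∀ u, Tendsto (fun x => h (x + u) - h x) atTop (𝓝 0)) {ε : ℝ} (hε : 0 < ε) :
    ∃ X, ∀ x, X ≤ x → ∀ u ∈ Set.Icc (0 : ℝ) 1, |h (x + u) - h x| ≤ ε := by
  by_contra! hcon
  choose x hx u hu hxu using fun n : ℕ => hcon n
  -- On a bounded window pointwise convergence implies convergence in measure, also along a moving
  -- base point `y n → ∞`.
  have key : ∀ y : ℕ → ℝ, Tendsto y atTop atTop → Tendsto (fun n =>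
      (volume.restrict (Set.Icc (0 : ℝ) 2)) {v | ε / 2 ≤ |h (y n + v) - h (y n)|})
      atTop (𝓝 0) := by
    intro y hy
    have hm : ∀ n, Measurable (fun v => h (y n + v) - h (y n)) := fun n =>
      (hh.comp (measurable_const_add _)).sub_const _
    have := tendstoInMeasure_of_tendsto_ae (μ := volume.restrict (Set.Icc (0 : ℝ) 2))
      (f := fun n v => h (y n + v) - h (y n)) (g := fun _ => 0)
      (fun n => (hm n).aestronglyMeasurable)
      (Eventually.of_forall fun v => (H v).comp hy)
    rw [tendstoInMeasure_iff_norm] at this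
    simpa using this (ε / 2) (by positivity)
  have hx' : Tendsto x atTop atTop := tendsto_atTop_mono hx tendsto_natCast_atTop_atTop
  have hy' : Tendsto (fun n => x n + u n) atTop atTop :=
    tendsto_atTop_mono (fun n => le_add_of_nonneg_right (hu n).1) hx'
  have e1 := (key _ hx').eventually (gt_mem_nhds (show (0 : ENNReal) < 1 / 2 by norm_num))
  have e2 := (key _ hy').eventually (gt_mem_nhds (show (0 : ENNReal) < 1 / 2 by norm_num))
  obtain ⟨n, h1, h2⟩ := (e1.and e2).exists
  obtain ⟨hu0, hu1⟩ := hu n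
  rw [Measure.restrict_apply' measurableSet_Icc] at h1 h2
  -- An increment above `ε` from `x n` to `x n + u n` forces each `v` to have an increment of at
  -- least `ε / 2` from one of these two base points. So two sets of measure below `1 / 2` would
  -- cover an interval of length `2 - u n ≥ 1`.
  have hsub : Set.Icc (u n) 2 ⊆
      ({v | ε / 2 ≤ |h (x n + v) - h (x n)|} ∩ Set.Icc 0 2) ∪
      (fun v => v + (-u n)) ⁻¹' ({v | ε / 2 ≤ |h (x n + u n + v) - h (x n + u n)|} ∩
        Set.Icc 0 2) := by
    rintro v ⟨hv1, hv2⟩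
    by_contra hv
    simp only [Set.mem_union, Set.mem_inter_iff, Set.mem_ofPred_eq, Set.mem_Icc,
      Set.mem_preimage, not_or, not_and, not_le] at hv
    have a1 : |h (x n + v) - h (x n)| < ε / 2 := by
      by_contra! hc
      linarith [hv.1 hc (by linarith)]
    have a2 : |h (x n + u n + (v + -u n)) - h (x n + u n)| < ε / 2 := by
      by_contra! hc
      linarith [hv.2 hc (by linarith)]
    rw [show x n + u n + (v + -u n) = x n + v by ring] at a2
    have := hxu n
    rw [abs_lt] at a1 a2
    rcases lt_abs.1 this with h' | h' <;> linarith [a1.1, a1.2, a2.1, a2.2]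
  have hle := (measure_mono (μ := volume) hsub).trans (measure_union_le _ _)
  rw [measure_preimage_add_right, Real.volume_Icc] at hle
  have h3 : ENNReal.ofReal (2 - u n) < 1 := by
    calc _ ≤ _ := hle
      _ < 1 / 2 + 1 / 2 := ENNReal.add_lt_add h1 h2
      _ = 1 := ENNReal.add_halves 1
  rw [ENNReal.ofReal_lt_one] at h3
  linarith

/-- Unit steps beyond `X` each add at most `ε`, and one fractional step reaches `x`. -/
theorem exists_forall_le_add_mul {h : ℝ → ℝ} (hh : Measurable h)
    (H : ∀ u, Tendsto (fun x => h (x + u) - h x) atTop (𝓝 0)) {ε : ℝ} (hε : 0 < ε) :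
    ∃ C, ∀ᶠ x in atTop, h x ≤ C + ε * x := by
  obtain ⟨X, hX⟩ := exists_forall_abs_add_sub_le hh H hε
  have step : ∀ n : ℕ, h (X + n) ≤ h X + ε * n := by
    intro n
    induction n with
    | zero => simp
    | succ n ih =>
      have := (abs_le.1 (hX (X + n) (by simp) 1 (by simp))).2
      push_cast
      rw [← add_assoc]
      linarith
  refine ⟨h X + ε - ε * X, eventually_atTop.2 ⟨X, fun x hx => ?_⟩⟩
  have hfl := Nat.floor_le (sub_nonneg.2 hx)
  have hlt := Nat.lt_floor_add_one (x - X)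
  set n := ⌊x - X⌋₊
  have := (abs_le.1 (hX (X + n) (by simp) (x - X - n) ⟨by linarith, by linarith⟩)).2
  rw [show X + n + (x - X - n) = x by ring] at this
  nlinarith [step n]

/-- In the variable `log x`, slow variation says that `log ∘ L ∘ exp` has vanishing increments,
hence grows with slope at most `D / 2`; thus `L x ≤ e ^ C * x ^ (D / 2)` eventually. -/
theorem SelfNormWilcoxon.IsSlowlyVarying.tendsto_rpow_neg_mul {L : ℝ → ℝ}
    (hL : SelfNormWilcoxon.IsSlowlyVarying L) {D : ℝ} (hD : 0 < D) :
    Tendsto (fun x : ℝ => x ^ (-D) * L x) atTop (𝓝 0) := by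
  have hpos : ∀ᶠ x in atTop, 0 < L (Real.exp x) := Real.tendsto_exp_atTop.eventually hL.eventually_pos
  have H : ∀ u, Tendsto (fun x => Real.log (L (Real.exp (x + u))) - Real.log (L (Real.exp x)))
      atTop (𝓝 0) := by
    intro u
    have h1 := ((hL.tendsto_ratio (Real.exp u) (Real.exp_pos u)).comp Real.tendsto_exp_atTop).log
      one_ne_zero
    rw [Real.log_one] at h1
    refine h1.congr' ?_
    have h2 : ∀ᶠ x in atTop, 0 < L (Real.exp (x + u)) :=
      (tendsto_atTop_add_const_right _ u tendsto_id).eventually hpos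
    filter_upwards [hpos, h2] with x hx hx2
    rw [Real.exp_add, mul_comm] at hx2
    simp only [Function.comp]
    rw [Real.log_div hx2.ne' hx.ne', Real.exp_add, mul_comm (Real.exp x)]
  obtain ⟨C, hC⟩ := exists_forall_le_add_mul
    (hL.measurable.comp Real.measurable_exp).log H (half_pos hD)
  have hC' := Real.tendsto_log_atTop.eventually hC
  have hlim : Tendsto (fun x : ℝ => Real.exp C * x ^ (-(D / 2))) atTop (𝓝 0) := by
    simpa using (tendsto_rpow_neg_atTop (half_pos hD)).const_mul (Real.exp C)
  refine squeeze_zero' ?_ ?_ hlim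
  · filter_upwards [hL.eventually_pos, eventually_gt_atTop 0] with x h1 h2
    positivity
  · filter_upwards [hL.eventually_pos, eventually_gt_atTop 0, hC'] with x h1 h2 h3
    rw [Function.comp_apply, Real.exp_log h2] at h3
    rw [← Real.exp_log h1, Real.rpow_def_of_pos h2, Real.rpow_def_of_pos h2, ← Real.exp_add,
      ← Real.exp_add, Real.exp_le_exp]
    linarith

theorem SelfNormWilcoxon.IsLRDGaussian.tendsto_covariance {Ω : Type*} [MeasurableSpace Ω]
    {P : Measure Ω} {ξ : ℕ → Ω → ℝ} {D : ℝ} (hξ : SelfNormWilcoxon.IsLRDGaussian P ξ D)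
    (hD : 0 < D) : Tendsto (fun k : ℕ => cov[ξ 1, ξ (1 + k); P]) atTop (𝓝 0) := by
  obtain ⟨L, hL, hequiv⟩ := hξ.long_range
  exact hequiv.symm.tendsto_nhds
    ((hL.tendsto_rpow_neg_mul hD).comp tendsto_natCast_atTop_atTop)

/-! ### Weakly correlated Gaussian pairs -/

section

/-- Dominated convergence: `r` enters only through the continuous factor `g`, so `f` may be merely
measurable. -/
theorem tendsto_integral_mul_comp_rotation (f : ℝ → ℝ) (hf : Measurable f)
    (hf1 : ∀ x, |f x| ≤ 1) (g : BoundedContinuousFunction ℝ ℝ) (ν : Measure ℝ)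
    [IsProbabilityMeasure ν] :
    Tendsto (fun r : ℝ => ∫ p : ℝ × ℝ, f p.1 * g (r * p.1 + √(1 - r ^ 2) * p.2) ∂(ν.prod ν))
      (𝓝 0) (𝓝 ((∫ x, f x ∂ν) * ∫ x, g x ∂ν)) := by
  rw [← integral_prod_mul]
  refine tendsto_integral_filter_of_dominated_convergence (fun _ => ‖g‖) ?_ ?_
    (integrable_const _) ?_
  · refine Eventually.of_forall fun r => ?_
    have : Measurable (fun p : ℝ × ℝ => f p.1 * g (r * p.1 + √(1 - r ^ 2) * p.2)) :=
      (hf.comp measurable_fst).mul (g.continuous.measurable.comp (by fun_prop))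
    exact this.aestronglyMeasurable
  · refine Eventually.of_forall fun r => Eventually.of_forall fun p => ?_
    rw [norm_mul]
    calc _ ≤ 1 * ‖g‖ := mul_le_mul (hf1 _) (g.norm_coe_le_norm _) (norm_nonneg _) zero_le_one
      _ = ‖g‖ := one_mul _
  · refine Eventually.of_forall fun p => Tendsto.const_mul _ ?_
    have h : Continuous (fun r : ℝ => g (r * p.1 + √(1 - r ^ 2) * p.2)) :=
      g.continuous.comp (by fun_prop)
    simpa using h.tendsto 0

variable {Ω : Type*} [MeasurableSpace Ω] {P : Measure Ω}

theorem ProbabilityTheory.HasGaussianLaw.map_eq_gaussianReal_zero_one {X : Ω → ℝ}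
    (hX : HasGaussianLaw X P) (h0 : ∫ ω, X ω ∂P = 0) (h1 : Var[X; P] = 1) :
    P.map X = gaussianReal 0 1 := by
  rw [hX.map_eq_gaussianReal, h0, h1, Real.toNNReal_one]

/-- The law of a standard Gaussian pair with correlation `r`, as the image of a product measure. -/
theorem map_prodMk_eq_map_rotation {X Y : Ω → ℝ}
    (hXY : HasGaussianLaw (fun ω => (X ω, Y ω)) P) (hX0 : ∫ ω, X ω ∂P = 0) (hX1 : Var[X; P] = 1)
    (hY0 : ∫ ω, Y ω ∂P = 0) (hY1 : Var[Y; P] = 1) {r : ℝ} (hr : cov[X, Y; P] = r)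
    (hr1 : |r| < 1) :
    P.map (fun ω => (X ω, Y ω)) = ((gaussianReal 0 1).prod (gaussianReal 0 1)).map
      (fun p => (p.1, r * p.1 + √(1 - r ^ 2) * p.2)) := by
  have := hXY.isProbabilityMeasure
  have hs : 0 < 1 - r ^ 2 := by
    rw [abs_lt] at hr1
    nlinarith
  have hs' := Real.sqrt_pos.2 hs
  set s := √(1 - r ^ 2) with hsdef
  have hs2 : s ^ 2 = 1 - r ^ 2 := Real.sq_sqrt hs.le
  -- The normalized residual of the regression of `Y` on `X`; being uncorrelated with `X` and
  -- jointly Gaussian, it is independent of `X`.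
  set Z : Ω → ℝ := fun ω => s⁻¹ * (Y ω - r * X ω) with hZ
  have hXZ : HasGaussianLaw (fun ω => (X ω, Z ω)) P := by
    refine (hXY.map ((ContinuousLinearMap.fst ℝ ℝ ℝ).prod (s⁻¹ • (ContinuousLinearMap.snd ℝ ℝ ℝ
      - r • ContinuousLinearMap.fst ℝ ℝ ℝ)))).congr (Eventually.of_forall fun ω => ?_)
    simp [hZ]
  have mX := hXY.fst.memLp_two
  have mY := hXY.snd.memLp_two
  have mrX : MemLp (fun ω => r * X ω) 2 P := mX.const_mul r
  have hX1' : cov[X, X; P] = 1 := by rw [covariance_self hXY.fst.aemeasurable, hX1]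
  have hY1' : cov[Y, Y; P] = 1 := by rw [covariance_self hXY.snd.aemeasurable, hY1]
  have hcov : cov[X, Z; P] = 0 := by
    rw [hZ, covariance_const_mul_right, covariance_fun_sub_right mX mY mrX,
      covariance_const_mul_right, hr, hX1']
    simp
  have hvar : Var[Z; P] = 1 := by
    rw [← covariance_self hXZ.snd.aemeasurable, hZ, covariance_const_mul_right,
      covariance_const_mul_left, covariance_fun_sub_fun_sub mY mrX mY mrX,
      covariance_const_mul_right, covariance_const_mul_left, covariance_const_mul_left,
      covariance_const_mul_right, covariance_comm Y X, hr, hX1', hY1']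
    field_simp
    linarith
  have hmean : ∫ ω, Z ω ∂P = 0 := by
    simp only [hZ]
    rw [integral_const_mul, integral_sub hXY.snd.integrable (hXY.fst.integrable.const_mul r),
      integral_const_mul, hX0, hY0]
    simp
  have hind := (indepFun_iff_map_prod_eq_prod_map_map hXZ.fst.aemeasurable
    hXZ.snd.aemeasurable).1 (hXZ.indepFun_of_covariance_eq_zero hcov)
  rw [hXZ.fst.map_eq_gaussianReal_zero_one hX0 hX1,
    hXZ.snd.map_eq_gaussianReal_zero_one hmean hvar] at hind
  rw [← hind, AEMeasurable.map_map_of_aemeasurable (by fun_prop) hXZ.aemeasurable]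
  congr 1
  ext ω
  · rfl
  · simp only [Function.comp, hZ]
    field_simp
    ring

/-- Bounded functions of two standard Gaussian variables are asymptotically uncorrelated as the
correlation of the variables tends to zero. -/
theorem exists_forall_abs_covariance_comp_le (f : ℝ → ℝ) (hf : Measurable f)
    (hf1 : ∀ x, |f x| ≤ 1) {ε : ℝ} (hε : 0 < ε) :
    ∃ δ > 0, ∀ X Y : Ω → ℝ, HasGaussianLaw (fun ω => (X ω, Y ω)) P → ∫ ω, X ω ∂P = 0 →
      Var[X; P] = 1 → ∫ ω, Y ω ∂P = 0 → Var[Y; P] = 1 → |cov[X, Y; P]| < δ →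
      |cov[f ∘ X, f ∘ Y; P]| ≤ ε := by
  set γ := gaussianReal 0 1
  have hfγ : Integrable f γ := Integrable.of_bound hf.aestronglyMeasurable 1
    (Eventually.of_forall hf1)
  -- Only the factor `f ∘ Y` is smoothed. The three errors `ε / 3` come from replacing `f` by `g` in
  -- the joint integral, from the limit `r → 0`, and from returning to `f` in the product of means.
  obtain ⟨g, hg, hgi⟩ := hfγ.exists_boundedContinuous_integral_sub_le (show 0 < ε / 3 by positivity)
  obtain ⟨δ, hδ, hφ⟩ := Metric.tendsto_nhds_nhds.1
    (tendsto_integral_mul_comp_rotation f hf hf1 g γ) (ε / 3) (by positivity)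
  refine ⟨min δ 1, lt_min hδ one_pos, fun X Y hXY hX0 hX1 hY0 hY1 hr => ?_⟩
  have := hXY.isProbabilityMeasure
  have lX : P.map X = γ := hXY.fst.map_eq_gaussianReal_zero_one hX0 hX1
  have lY : P.map Y = γ := hXY.snd.map_eq_gaussianReal_zero_one hY0 hY1
  have aX := hXY.fst.aemeasurable
  have aY := hXY.snd.aemeasurable
  have mX : MemLp (f ∘ X) 2 P := MemLp.of_bound (hf.comp_aemeasurable aX).aestronglyMeasurable 1
    (Eventually.of_forall fun ω => hf1 _)
  have mY : MemLp (f ∘ Y) 2 P := MemLp.of_bound (hf.comp_aemeasurable aY).aestronglyMeasurable 1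
    (Eventually.of_forall fun ω => hf1 _)
  have eX : ∫ ω, f (X ω) ∂P = ∫ x, f x ∂γ := by
    rw [← lX, integral_map aX hf.aestronglyMeasurable]
  have eY : ∫ ω, f (Y ω) ∂P = ∫ x, f x ∂γ := by
    rw [← lY, integral_map aY hf.aestronglyMeasurable]
  have eYd : ∫ ω, |f (Y ω) - g (Y ω)| ∂P = ∫ x, |f x - g x| ∂γ := by
    rw [← lY]
    exact (integral_map aY (f := fun x => |f x - g x|)
      (hf.sub g.continuous.measurable).norm.aestronglyMeasurable).symm
  have hgm : Measurable g := g.continuous.measurable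
  have eXY : ∫ ω, f (X ω) * g (Y ω) ∂P =
      ∫ p : ℝ × ℝ, f p.1 * g (cov[X, Y; P] * p.1 + √(1 - cov[X, Y; P] ^ 2) * p.2) ∂(γ.prod γ) := by
    have hm : Measurable (fun q : ℝ × ℝ => f q.1 * g q.2) :=
      (hf.comp measurable_fst).mul (hgm.comp measurable_snd)
    have h1 := integral_map (μ := P) hXY.aemeasurable (f := fun q : ℝ × ℝ => f q.1 * g q.2)
      hm.aestronglyMeasurable
    rw [map_prodMk_eq_map_rotation hXY hX0 hX1 hY0 hY1 rfl (hr.trans_le (min_le_right _ _)),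
      integral_map (by fun_prop) hm.aestronglyMeasurable] at h1
    exact h1.symm
  have h1 : |∫ ω, f (X ω) * f (Y ω) ∂P - ∫ ω, f (X ω) * g (Y ω) ∂P| ≤ ε / 3 := by
    have i1 : Integrable (fun ω => f (X ω) * f (Y ω)) P := mX.integrable_mul mY
    have i2 : Integrable (fun ω => f (X ω) * g (Y ω)) P := by
      refine Integrable.of_bound ((hf.comp_aemeasurable aX).mul
        (hgm.comp_aemeasurable aY)).aestronglyMeasurable ‖g‖ (Eventually.of_forall fun ω => ?_)
      rw [norm_mul]
      calc _ ≤ 1 * ‖g‖ := mul_le_mul (hf1 _) (g.norm_coe_le_norm _) (norm_nonneg _) zero_le_one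
        _ = ‖g‖ := one_mul _
    have i3 : Integrable (fun ω => |f (Y ω) - g (Y ω)|) P := by
      have : Integrable (fun x => |f x - g x|) (P.map Y) := by rw [lY]; exact (hfγ.sub hgi).abs
      exact this.comp_aemeasurable aY
    rw [← integral_sub i1 i2]
    refine (abs_integral_le_integral_abs).trans ((integral_mono (i1.sub i2).abs i3 fun ω => ?_).trans
      (eYd.le.trans hg))
    simp only [Pi.sub_apply]
    rw [← mul_sub, abs_mul]
    exact mul_le_of_le_one_left (abs_nonneg _) (hf1 _)
  have h2 := hφ (x := cov[X, Y; P]) (by simpa using hr.trans_le (min_le_left _ _))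
  rw [← eXY, Real.dist_eq] at h2
  have h3 : |(∫ x, f x ∂γ) * ∫ x, g x ∂γ - (∫ x, f x ∂γ) * ∫ x, f x ∂γ| ≤ ε / 3 := by
    rw [← mul_sub, abs_mul]
    have a1 : |∫ x, f x ∂γ| ≤ 1 := by
      have := norm_integral_le_of_norm_le_const (μ := γ) (f := f) (C := 1)
        (Eventually.of_forall hf1)
      simpa using this
    have a2 : |∫ x, g x ∂γ - ∫ x, f x ∂γ| ≤ ε / 3 := by
      rw [abs_sub_comm, ← integral_sub hfγ hgi]
      exact abs_integral_le_integral_abs.trans hg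
    exact (mul_le_of_le_one_left (abs_nonneg _) a1).trans a2
  rw [covariance_eq_sub mX mY]
  simp only [Pi.mul_apply, Function.comp_apply, eX, eY]
  rw [abs_le] at *
  rw [abs_lt] at h2
  constructor <;> linarith [h1.1, h1.2, h2.1, h2.2, h3.1, h3.2]

end

/-! ### Variances of partial sums -/

section

variable {Ω : Type*} [MeasurableSpace Ω] {P : Measure Ω}

theorem abs_covariance_le_two [IsProbabilityMeasure P] {X Y : Ω → ℝ} (hX : MemLp X 2 P)
    (hY : MemLp Y 2 P) (hX1 : ∀ ω, |X ω| ≤ 1) (hY1 : ∀ ω, |Y ω| ≤ 1) : |cov[X, Y; P]| ≤ 2 := by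
  have key : ∀ Z : Ω → ℝ, (∀ ω, |Z ω| ≤ 1) → |∫ ω, Z ω ∂P| ≤ 1 := fun Z hZ => by
    have := norm_integral_le_of_norm_le_const (μ := P) (f := Z) (C := 1) (Eventually.of_forall hZ)
    simpa using this
  rw [covariance_eq_sub hX hY]
  have h1 := key (X * Y) fun ω => by
    rw [Pi.mul_apply, abs_mul]
    exact mul_le_one₀ (hX1 ω) (abs_nonneg _) (hY1 ω)
  have h2 : |(∫ ω, X ω ∂P) * ∫ ω, Y ω ∂P| ≤ 1 := by
    rw [abs_mul]
    exact mul_le_one₀ (key X hX1) (abs_nonneg _) (key Y hY1)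
  exact (abs_sub _ _).trans (by linarith)

/-- Each row of the covariance matrix has at most `2K + 1` entries near the diagonal, each at most
`2`, and the others are at most `δ / 2`; for large `n` the band also contributes at most `n δ / 2`
per row. -/
theorem eventually_variance_sum_le [IsProbabilityMeasure P] {Z : ℕ → Ω → ℝ}
    (hZ : ∀ i, 1 ≤ i → MemLp (Z i) 2 P) (hZ1 : ∀ i ω, |Z i ω| ≤ 1)
    (hcov : ∀ ε > 0, ∃ K : ℕ, ∀ i, 1 ≤ i → ∀ k, K ≤ k → |cov[Z i, Z (i + k); P]| ≤ ε)
    {δ : ℝ} (hδ : 0 < δ) :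
    ∀ᶠ n : ℕ in atTop, ∀ t ≤ n, Var[∑ i ∈ Finset.Icc 1 t, Z i; P] ≤ δ * (n : ℝ) ^ 2 := by
  obtain ⟨K, hK⟩ := hcov (δ / 2) (by positivity)
  have hlarge : ∀ᶠ n : ℕ in atTop, 2 * (2 * K + 1) / (δ / 2) ≤ (n : ℝ) :=
    tendsto_natCast_atTop_atTop.eventually (eventually_ge_atTop _)
  filter_upwards [hlarge] with n hn t ht
  rw [div_le_iff₀ (by positivity)] at hn
  rw [variance_sum' fun i hi => hZ i (Finset.mem_Icc.1 hi).1]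
  have htn : (t : ℝ) ≤ n := by exact_mod_cast ht
  have hterm : ∀ i ∈ Finset.Icc 1 t, ∀ j ∈ Finset.Icc 1 t,
      cov[Z i, Z j; P] ≤ δ / 2 + if j ∈ Finset.Icc (i - K) (i + K) then 2 else 0 := by
    intro i hi j hj
    have hi1 := (Finset.mem_Icc.1 hi).1
    have hj1 := (Finset.mem_Icc.1 hj).1
    split_ifs with h
    · have := (abs_le.1 (abs_covariance_le_two (hZ i hi1) (hZ j hj1) (hZ1 i) (hZ1 j))).2
      linarith
    · rw [add_zero]
      rw [Finset.mem_Icc] at h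
      rcases le_total i j with hij | hij
      · obtain ⟨k, rfl⟩ := Nat.exists_eq_add_of_le hij
        exact (abs_le.1 (hK i hi1 k (by omega))).2
      · obtain ⟨k, rfl⟩ := Nat.exists_eq_add_of_le hij
        rw [covariance_comm]
        exact (abs_le.1 (hK j hj1 k (by omega))).2
  have hrow : ∀ i ∈ Finset.Icc 1 t, ∑ j ∈ Finset.Icc 1 t, cov[Z i, Z j; P] ≤ n * δ := by
    intro i hi
    refine (Finset.sum_le_sum (hterm i hi)).trans ?_
    rw [Finset.sum_add_distrib, Finset.sum_const, Nat.card_Icc, ← Finset.sum_filter,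
      Finset.sum_const, nsmul_eq_mul, nsmul_eq_mul]
    have hcard : (Finset.card {j ∈ Finset.Icc 1 t | j ∈ Finset.Icc (i - K) (i + K)} : ℝ)
        ≤ 2 * K + 1 := by
      have h1 : Finset.card {j ∈ Finset.Icc 1 t | j ∈ Finset.Icc (i - K) (i + K)} ≤ 2 * K + 1 := by
        refine (Finset.card_le_card (t := Finset.Icc (i - K) (i + K)) fun j hj =>
          (Finset.mem_filter.1 hj).2).trans ?_
        rw [Nat.card_Icc]
        omega
      exact_mod_cast h1
    rw [Nat.add_sub_cancel]
    nlinarith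
  refine (Finset.sum_le_sum hrow).trans ?_
  rw [Finset.sum_const, Nat.card_Icc, nsmul_eq_mul, Nat.add_sub_cancel]
  nlinarith [mul_nonneg (Nat.cast_nonneg (α := ℝ) n) hδ.le]

/-! ### Counting functions and grids in time and level -/

/-- The number of `i ∈ {1, …, t}` with `y i ≤ x`. -/
noncomputable def countLE (y : ℕ → ℝ) (t : ℕ) (x : ℝ) : ℝ :=
  ∑ i ∈ Finset.Icc 1 t, if y i ≤ x then (1 : ℝ) else 0

theorem countLE_mono (y : ℕ → ℝ) {s t : ℕ} (hst : s ≤ t) {u v : ℝ} (huv : u ≤ v) :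
    countLE y s u ≤ countLE y t v := by
  have h0 : ∀ i : ℕ, (0 : ℝ) ≤ if y i ≤ v then (1 : ℝ) else 0 := fun i => by split_ifs <;> simp
  refine (Finset.sum_le_sum fun i _ => ?_).trans (Finset.sum_le_sum_of_subset_of_nonneg
    (Finset.Icc_subset_Icc_right hst) fun i _ _ => h0 i)
  split_ifs with h1 h2
  · exact le_rfl
  · exact absurd (h1.trans huv) h2
  · exact zero_le_one
  · exact le_rfl

theorem countLE_nonneg (y : ℕ → ℝ) (t : ℕ) (x : ℝ) : 0 ≤ countLE y t x :=
  Finset.sum_nonneg fun i _ => by split_ifs <;> simp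

theorem countLE_le (y : ℕ → ℝ) (t : ℕ) (x : ℝ) : countLE y t x ≤ t := by
  calc countLE y t x ≤ ∑ i ∈ Finset.Icc 1 t, (1 : ℝ) :=
        Finset.sum_le_sum fun i _ => by split_ifs <;> simp
    _ = t := by simp

/-- A finite grid on which a continuous distribution function varies little. -/
theorem exists_finset_grid (ν : Measure ℝ) [IsProbabilityMeasure ν] (hF : Continuous (cdf ν))
    {ε : ℝ} (hε : 0 < ε) :
    ∃ B : Finset ℝ, ∀ x, ((∃ u ∈ B, u ≤ x ∧ cdf ν x ≤ cdf ν u + ε) ∨ cdf ν x ≤ ε) ∧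
      ((∃ v ∈ B, x ≤ v ∧ cdf ν v ≤ cdf ν x + ε) ∨ 1 - ε ≤ cdf ν x) := by
  obtain ⟨N, hN⟩ := exists_nat_gt (1 / ε)
  have hN0 : (0 : ℝ) < N := lt_trans (by positivity) hN
  have hNε : 1 / (N : ℝ) < ε := by
    rw [div_lt_iff₀ hε] at hN
    rw [div_lt_iff₀ hN0]
    linarith
  have hsurj : ∀ p : ℝ, 0 < p → p < 1 → ∃ x, cdf ν x = p := fun p h0 h1 =>
    mem_range_of_exists_le_of_exists_ge hF
      (((tendsto_cdf_atBot ν).eventually (gt_mem_nhds h0)).exists.imp fun _ h => h.le)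
      (((tendsto_cdf_atTop ν).eventually (lt_mem_nhds h1)).exists.imp fun _ h => h.le)
  -- Grid points are quantiles at levels `j / N`. Levels `0` and `1` need not be attained, which is
  -- why the conclusion has separate tail alternatives.
  have hz : ∀ j : ℕ, ∃ x, 0 < j → j < N → cdf ν x = j / N := by
    intro j
    by_cases hj : 0 < j ∧ j < N
    · obtain ⟨x, hx⟩ := hsurj (j / N) (div_pos (by exact_mod_cast hj.1) hN0)
        ((div_lt_one hN0).2 (by exact_mod_cast hj.2))
      exact ⟨x, fun _ _ => hx⟩
    · exact ⟨0, fun h1 h2 => absurd ⟨h1, h2⟩ hj⟩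
  choose z hz using hz
  refine ⟨(Finset.range N).image z, fun x => ⟨?_, ?_⟩⟩
  · by_cases hx : cdf ν x ≤ ε
    · exact Or.inr hx
    left
    have hpos : 0 < cdf ν x := hε.trans (not_le.1 hx)
    -- The ceiling minus one gives a level strictly below `cdf ν x`, so monotonicity places the
    -- quantile to the left of `x`.
    set j := ⌈cdf ν x * N⌉₊ with hj
    have hj1 : cdf ν x * N ≤ j := Nat.le_ceil _
    have hj2 : (j : ℝ) < cdf ν x * N + 1 := Nat.ceil_lt_add_one (by positivity)
    have hjN : j ≤ N := Nat.ceil_le.2 (by nlinarith [cdf_le_one ν x])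
    have hj3 : 1 < j := by
      have : 1 / (N : ℝ) < cdf ν x := hNε.trans (not_le.1 hx)
      rw [div_lt_iff₀ hN0] at this
      exact_mod_cast this.trans_le hj1
    obtain ⟨i, hi⟩ : ∃ i, j = i + 1 := ⟨j - 1, by omega⟩
    have hzi := hz i (by omega) (by omega)
    rw [hi] at hj1 hj2
    push_cast at hj1 hj2
    refine ⟨z i, Finset.mem_image_of_mem _ (Finset.mem_range.2 (by omega)), ?_, ?_⟩
    · by_contra! hlt
      have := monotone_cdf ν hlt.le
      rw [hzi, le_div_iff₀ hN0] at this
      linarith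
    · rw [hzi]
      have : cdf ν x ≤ (i + 1) / N := (le_div_iff₀ hN0).2 hj1
      rw [add_div] at this
      linarith
  · by_cases hx : 1 - ε ≤ cdf ν x
    · exact Or.inr hx
    left
    have h0 := cdf_nonneg ν x
    set j := ⌊cdf ν x * N⌋₊ with hj
    have hj1 : (j : ℝ) ≤ cdf ν x * N := Nat.floor_le (by positivity)
    have hj2 : cdf ν x * N < j + 1 := Nat.lt_floor_add_one _
    have hjN : j + 1 < N := by
      have h1 : cdf ν x < 1 - 1 / N := by linarith
      have h2 : cdf ν x * N < (1 - 1 / N) * N := mul_lt_mul_of_pos_right h1 hN0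
      rw [sub_mul, one_div_mul_cancel hN0.ne', one_mul] at h2
      have h3 : (j : ℝ) + 1 < N := by linarith
      exact_mod_cast h3
    have hzi := hz (j + 1) (by omega) hjN
    push_cast at hzi
    refine ⟨z (j + 1), Finset.mem_image_of_mem _ (Finset.mem_range.2 hjN), ?_, ?_⟩
    · by_contra! hlt
      have := monotone_cdf ν hlt.le
      rw [hzi, div_le_iff₀ hN0] at this
      linarith
    · rw [hzi, add_div]
      have : (j : ℝ) / N ≤ cdf ν x := (div_le_iff₀ hN0).2 hj1
      linarith

/-- Passing from a grid in time and space to uniform closeness of the sequential empirical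
distribution function. -/
theorem abs_countLE_sub_le_of_grid (ν : Measure ℝ) [IsProbabilityMeasure ν] {ε : ℝ} (hε : 0 < ε)
    (hε1 : ε ≤ 1) {B : Finset ℝ}
    (hB : ∀ x, ((∃ u ∈ B, u ≤ x ∧ cdf ν x ≤ cdf ν u + ε) ∨ cdf ν x ≤ ε) ∧
      ((∃ v ∈ B, x ≤ v ∧ cdf ν v ≤ cdf ν x + ε) ∨ 1 - ε ≤ cdf ν x))
    {y : ℕ → ℝ} {n l : ℕ} (hl1 : ε * n ≤ l) (hl0 : 0 < l) (hl2 : (l : ℝ) ≤ 2 * (ε * n)) {A : ℕ}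
    (hA : 1 / ε ≤ A)
    (h : ∀ a ≤ A + 1, ∀ u ∈ B, |countLE y (a * l) u - (a * l : ℕ) * cdf ν u| ≤ ε * n)
    {t : ℕ} (ht : t ≤ n) (x : ℝ) :
    |countLE y t x - t * cdf ν x| ≤ 6 * ε * n := by
  have hF0 := cdf_nonneg ν
  have hF1 := cdf_le_one ν
  have htn : (t : ℝ) ≤ n := by exact_mod_cast ht
  have ht0 : (0 : ℝ) ≤ t := Nat.cast_nonneg t
  have hn0 : (0 : ℝ) ≤ n := Nat.cast_nonneg n
  -- Sandwich: `t` lies between the grid times `a * l` and `(a + 1) * l`, and `countLE` is monotone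
  -- in time and level.
  set a := t / l with ha
  have ha1 : a * l ≤ t := Nat.div_mul_le_self t l
  have ha2 : t ≤ (a + 1) * l := ((Nat.div_lt_iff_lt_mul hl0).1 (Nat.lt_succ_self _)).le
  have haA : a ≤ A := by
    have h1 : (a * l : ℝ) ≤ n := by exact_mod_cast ha1.trans ht
    have h2 : (n : ℝ) ≤ A * l := by
      rw [div_le_iff₀ hε] at hA
      have := mul_le_mul_of_nonneg_left hl1 (Nat.cast_nonneg (α := ℝ) A)
      nlinarith
    have h3 : (a : ℝ) ≤ A := le_of_mul_le_mul_right (h1.trans h2) (by exact_mod_cast hl0)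
    exact_mod_cast h3
  have ha1' : (a * l : ℝ) ≤ t := by exact_mod_cast ha1
  have ha2' : (t : ℝ) ≤ a * l + l := by
    have : (t : ℝ) ≤ ((a + 1) * l : ℕ) := by exact_mod_cast ha2
    push_cast at this
    linarith
  have hal0 : (0 : ℝ) ≤ a * l := by positivity
  have hl0' : (0 : ℝ) ≤ l := Nat.cast_nonneg l
  have hεn : 0 ≤ ε * n := by positivity
  have htε : t * ε ≤ ε * n := by nlinarith
  obtain ⟨hlow, hup⟩ := hB x
  rw [abs_le]
  constructor
  · rcases hlow with ⟨u, hu, hux, hFu⟩ | hx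
    · have h1 := (abs_le.1 (h a (by omega) u hu)).1
      have h2 := countLE_mono y ha1 hux
      push_cast at h1
      have h3 : a * l * (cdf ν x - ε) ≤ a * l * cdf ν u :=
        mul_le_mul_of_nonneg_left (by linarith) hal0
      have h4 : a * l * ε ≤ t * ε := mul_le_mul_of_nonneg_right ha1' hε.le
      have h5 : t * cdf ν x ≤ (a * l + l) * cdf ν x := mul_le_mul_of_nonneg_right ha2' (hF0 x)
      have h6 : l * cdf ν x ≤ l := mul_le_of_le_one_right hl0' (hF1 x)
      nlinarith
    · have h1 := countLE_nonneg y t x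
      have h2 : t * cdf ν x ≤ t * ε := mul_le_mul_of_nonneg_left hx ht0
      linarith
  -- The error is at most `2 * l + t * ε + ε * n`, hence `6 * ε * n` since `l ≤ 2 * ε * n`.
  · rcases hup with ⟨v, hv, hxv, hFv⟩ | hx
    · have h1 := (abs_le.1 (h (a + 1) (by omega) v hv)).2
      have h2 := countLE_mono y ha2 hxv
      push_cast at h1
      have h3 : (a + 1) * l * cdf ν v ≤ (a * l + l) * (cdf ν x + ε) := by
        rw [add_mul, one_mul]
        exact mul_le_mul_of_nonneg_left hFv (by linarith)
      have h4 : a * l * ε ≤ t * ε := mul_le_mul_of_nonneg_right ha1' hε.le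
      have h5 : a * l * cdf ν x ≤ t * cdf ν x := mul_le_mul_of_nonneg_right ha1' (hF0 x)
      have h6 : l * cdf ν x ≤ l := mul_le_of_le_one_right hl0' (hF1 x)
      have h7 : l * ε ≤ l := mul_le_of_le_one_right hl0' hε1
      nlinarith
    · have h1 := countLE_le y t x
      have h2 : t * (1 - ε) ≤ t * cdf ν x := mul_le_mul_of_nonneg_left hx ht0
      linarith

end

/-! ### Uniform law of large numbers for the subordinated sequence -/

section

variable {Ω : Type*} [MeasurableSpace Ω] {P : Measure Ω}

namespace SelfNormWilcoxon.IsLRDGaussian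

variable {ξ : ℕ → Ω → ℝ} {D : ℝ}

theorem hasGaussianLaw (hξ : IsLRDGaussian P ξ D) {i : ℕ} (hi : 1 ≤ i) :
    HasGaussianLaw (ξ i) P :=
  hξ.gaussian.hasGaussianLaw_eval ⟨i, hi⟩

theorem map_eq (hξ : IsLRDGaussian P ξ D) {i : ℕ} (hi : 1 ≤ i) :
    P.map (ξ i) = gaussianReal 0 1 :=
  (hξ.hasGaussianLaw hi).map_eq_gaussianReal_zero_one (hξ.mean_zero i hi) (hξ.variance_one i hi)

theorem exists_forall_abs_covariance_comp_le (hξ : IsLRDGaussian P ξ D) (hD : 0 < D) {f : ℝ → ℝ}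
    (hf : Measurable f) (hf1 : ∀ x, |f x| ≤ 1) {ε : ℝ} (hε : 0 < ε) :
    ∃ K : ℕ, ∀ i, 1 ≤ i → ∀ k, K ≤ k → |cov[f ∘ ξ i, f ∘ ξ (i + k); P]| ≤ ε := by
  obtain ⟨δ, hδ, h⟩ := _root_.exists_forall_abs_covariance_comp_le (P := P) f hf hf1 hε
  obtain ⟨K, hK⟩ := Metric.tendsto_atTop.1 (hξ.tendsto_covariance hD) δ hδ
  refine ⟨K, fun i hi k hk => h _ _ ?_ (hξ.mean_zero i hi) (hξ.variance_one i hi)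
    (hξ.mean_zero _ (by omega)) (hξ.variance_one _ (by omega)) ?_⟩
  · exact hξ.gaussian.hasGaussianLaw_prodMk (s := ⟨i, hi⟩)
      (t := ⟨i + k, Set.mem_Ici.2 (by omega)⟩)
  · rw [hξ.stationary i hi k]
    simpa using hK k hk

theorem integral_ite_eq_cdf [IsProbabilityMeasure P] (hξ : IsLRDGaussian P ξ D) {G : ℝ → ℝ}
    (hG : Measurable G) (x : ℝ) {i : ℕ} (hi : 1 ≤ i) :
    ∫ ω, (if G (ξ i ω) ≤ x then (1 : ℝ) else 0) ∂P = cdf (P.map (fun ω => G (ξ 1 ω))) x := by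
  have hm1 : AEMeasurable (fun ω => G (ξ 1 ω)) P :=
    hG.comp_aemeasurable (hξ.hasGaussianLaw le_rfl).aemeasurable
  have hmi := (hξ.hasGaussianLaw hi).aemeasurable
  have : IsProbabilityMeasure (P.map (fun ω => G (ξ 1 ω))) :=
    Measure.isProbabilityMeasure_map hm1
  have hS : MeasurableSet {z | G z ≤ x} := measurableSet_le hG measurable_const
  have hmap : P.map (fun ω => G (ξ 1 ω)) = (P.map (ξ i)).map G := by
    rw [hξ.map_eq hi, ← hξ.map_eq le_rfl, AEMeasurable.map_map_of_aemeasurable hG.aemeasurable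
      (hξ.hasGaussianLaw le_rfl).aemeasurable]
    rfl
  have hf : Measurable (fun z => if G z ≤ x then (1 : ℝ) else 0) :=
    Measurable.ite hS measurable_const measurable_const
  rw [cdf_eq_real, hmap, map_measureReal_apply hG measurableSet_Iic,
    ← integral_map hmi (f := fun z => if G z ≤ x then (1 : ℝ) else 0) hf.aestronglyMeasurable]
  exact integral_indicator_one hS

/-- Chebyshev's inequality. Deviations are measured on the scale `n` rather than `t`, so the
variance bound is uniform in `t ≤ n`. -/
theorem eventually_measure_countLE_le [IsProbabilityMeasure P] (hξ : IsLRDGaussian P ξ D)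
    (hD : 0 < D) {G : ℝ → ℝ} (hG : Measurable G) (x : ℝ) {η : ℝ} (hη : 0 < η) {δ : ENNReal}
    (hδ : δ ≠ 0) :
    ∀ᶠ n : ℕ in atTop, ∀ t ≤ n, P {ω | η * n ≤ |countLE (fun i => G (ξ i ω)) t x
      - t * cdf (P.map (fun ω => G (ξ 1 ω))) x|} ≤ δ := by
  obtain ⟨δ', hδ0, hδ'⟩ : ∃ δ' : ℝ, 0 < δ' ∧ ENNReal.ofReal δ' ≤ δ := by
    obtain ⟨r, hr, hrδ⟩ := ENNReal.lt_iff_exists_nnreal_btwn.1 (pos_iff_ne_zero.2 hδ)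
    exact ⟨r, by exact_mod_cast hr, by simpa using hrδ.le⟩
  set f : ℝ → ℝ := fun z => if G z ≤ x then 1 else 0 with hfdef
  have hf : Measurable f :=
    Measurable.ite (measurableSet_le hG measurable_const) measurable_const measurable_const
  have hf1 : ∀ z, |f z| ≤ 1 := fun z => by
    simp only [hfdef]
    split_ifs <;> simp
  have hmem : ∀ i, 1 ≤ i → MemLp (f ∘ ξ i) 2 P := fun i hi => MemLp.of_bound
    (hf.comp_aemeasurable (hξ.hasGaussianLaw hi).aemeasurable).aestronglyMeasurable 1
    (Eventually.of_forall fun ω => hf1 _)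
  have hvar := eventually_variance_sum_le (P := P) (Z := fun i => f ∘ ξ i) hmem
    (fun i ω => hf1 _) (fun ε hε => hξ.exists_forall_abs_covariance_comp_le hD hf hf1 hε)
    (δ := δ' * η ^ 2) (by positivity)
  filter_upwards [hvar, eventually_gt_atTop 0] with n hn hn0 t ht
  have hn0' : (0 : ℝ) < n := by exact_mod_cast hn0
  have hsum : MemLp (∑ i ∈ Finset.Icc 1 t, f ∘ ξ i) 2 P :=
    memLp_finsetSum' _ fun i hi => hmem i (Finset.mem_Icc.1 hi).1
  have hmean : ∫ ω, (∑ i ∈ Finset.Icc 1 t, f ∘ ξ i) ω ∂P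
      = t * cdf (P.map (fun ω => G (ξ 1 ω))) x := by
    simp only [Finset.sum_apply]
    rw [integral_finsetSum _ fun i hi =>
      (hmem i (Finset.mem_Icc.1 hi).1).integrable one_le_two]
    refine (Finset.sum_congr rfl fun i hi =>
      hξ.integral_ite_eq_cdf hG x (Finset.mem_Icc.1 hi).1).trans ?_
    simp
  have := meas_ge_le_variance_div_sq hsum (c := η * n) (by positivity)
  rw [hmean] at this
  simp only [Finset.sum_apply] at this
  refine this.trans (le_trans (ENNReal.ofReal_le_ofReal ?_) hδ')
  rw [div_le_iff₀ (by positivity)]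
  linarith [hn t ht, show δ' * η ^ 2 * (n : ℝ) ^ 2 = δ' * (η * n) ^ 2 by ring]

/-- The sequential empirical distribution function of a subordinated Gaussian sequence converges
in probability, uniformly in time and space. -/
theorem tendsto_measure_empirical_deviation [IsProbabilityMeasure P] (hξ : IsLRDGaussian P ξ D)
    (hD : 0 < D) {G : ℝ → ℝ} (hG : Measurable G)
    (hF : Continuous (cdf (P.map (fun ω => G (ξ 1 ω))))) {ε : ℝ} (hε : 0 < ε) :
    Tendsto (fun n : ℕ => P {ω | ¬ ∀ t ≤ n, ∀ x, |countLE (fun i => G (ξ i ω)) t x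
      - t * cdf (P.map (fun ω => G (ξ 1 ω))) x| ≤ ε * n}) atTop (𝓝 0) := by
  have hm1 : AEMeasurable (fun ω => G (ξ 1 ω)) P :=
    hG.comp_aemeasurable (hξ.hasGaussianLaw le_rfl).aemeasurable
  have : IsProbabilityMeasure (P.map (fun ω => G (ξ 1 ω))) :=
    Measure.isProbabilityMeasure_map hm1
  set ν := P.map (fun ω => G (ξ 1 ω)) with hν
  set e : ℝ := min (ε / 6) 1 with he
  have he0 : 0 < e := lt_min (by positivity) one_pos
  have he1 : e ≤ 1 := min_le_right _ _
  have he6 : 6 * e ≤ ε := by linarith [min_le_left (ε / 6) 1]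
  obtain ⟨B, hB⟩ := exists_finset_grid ν hF he0
  obtain ⟨A, hA⟩ := exists_nat_ge (1 / e)
  set l : ℕ → ℕ := fun n => ⌊e * n⌋₊ + 1 with hl
  rw [ENNReal.tendsto_nhds_zero]
  intro δ hδ
  set I := (Finset.range (A + 2)) ×ˢ B with hI
  set δ' : ENNReal := δ / (I.card + 1) with hδ'
  have hδ'0 : δ' ≠ 0 := by
    simp only [hδ', ne_eq, ENNReal.div_eq_zero_iff, hδ.ne', false_or]
    exact ENNReal.add_ne_top.2 ⟨ENNReal.natCast_ne_top _, ENNReal.one_ne_top⟩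
  -- Grid times may exceed `n`, so the single-level bound is applied at sample size `N = n * (2 * (A
  -- + 2))`, which dominates them all; `c` is chosen so that `c * N = e * n`.
  set c : ℝ := e / (2 * (A + 2)) with hc
  have hc0 : 0 < c := by positivity
  have hev : ∀ᶠ N : ℕ in atTop, ∀ u ∈ B, ∀ t ≤ N, P {ω | c * N ≤
      |countLE (fun i => G (ξ i ω)) t u - t * cdf ν u|} ≤ δ' :=
    (Filter.eventually_all_finset B).2 fun u _ =>
      hξ.eventually_measure_countLE_le hD hG u hc0 hδ'0
  have hN : Tendsto (fun n : ℕ => n * (2 * (A + 2))) atTop atTop :=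
    tendsto_id.atTop_mul_const' (by positivity)
  have hlarge : ∀ᶠ n : ℕ in atTop, 1 / e ≤ (n : ℝ) :=
    tendsto_natCast_atTop_atTop.eventually (eventually_ge_atTop _)
  filter_upwards [hN.eventually hev, hlarge] with n hn hn1
  have hen : 1 ≤ e * n := by
    rw [div_le_iff₀ he0] at hn1
    linarith
  have hl1 : e * n ≤ l n := by
    simp only [hl]
    push_cast
    exact (Nat.lt_floor_add_one _).le
  have hl2 : (l n : ℝ) ≤ 2 * (e * n) := by
    simp only [hl]
    push_cast
    linarith [Nat.floor_le (show 0 ≤ e * n by linarith)]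
  have hln : l n ≤ n * 2 := by
    have : (l n : ℝ) ≤ n * 2 := by nlinarith [Nat.cast_nonneg (α := ℝ) n]
    exact_mod_cast this
  have hsub : {ω | ¬ ∀ t ≤ n, ∀ x, |countLE (fun i => G (ξ i ω)) t x - t * cdf ν x| ≤ ε * n} ⊆
      ⋃ p ∈ I, {ω | e * n ≤ |countLE (fun i => G (ξ i ω)) (p.1 * l n) p.2
        - (p.1 * l n : ℕ) * cdf ν p.2|} := by
    intro ω hω
    by_contra hcon
    refine hω fun t ht x => ?_
    refine (abs_countLE_sub_le_of_grid ν he0 he1 hB hl1 (Nat.succ_pos _) hl2 hA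
      (fun a ha u hu => ?_) ht x).trans
        (mul_le_mul_of_nonneg_right he6 (Nat.cast_nonneg n))
    by_contra! hlt
    refine hcon (Set.mem_biUnion (x := (a, u)) ?_ hlt.le)
    exact Finset.mem_coe.2 (Finset.mem_product.2 ⟨Finset.mem_range.2 (by omega), hu⟩)
  refine (measure_mono hsub).trans ((measure_biUnion_finset_le _ _).trans ?_)
  have hcn : c * ((n * (2 * (A + 2)) : ℕ) : ℝ) = e * n := by
    rw [hc]
    push_cast
    field_simp
  calc _ ≤ ∑ p ∈ I, δ' := by
        refine Finset.sum_le_sum fun p hp => ?_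
        obtain ⟨hp1, hp2⟩ := Finset.mem_product.1 hp
        have hp1' := Finset.mem_range.1 hp1
        have := hn p.2 hp2 (p.1 * l n) (by
          calc p.1 * l n ≤ (A + 2) * (n * 2) := Nat.mul_le_mul hp1'.le hln
            _ = n * (2 * (A + 2)) := by ring)
        rwa [hcn] at this
    _ = I.card * δ' := by rw [Finset.sum_const, nsmul_eq_mul]
    _ ≤ (I.card + 1) * δ' := mul_le_mul_left le_self_add _
    _ ≤ δ := ENNReal.mul_div_le

end SelfNormWilcoxon.IsLRDGaussian

end

/-! ### Strict effect of a shift -/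

/-- `P(Z - δ < Z')` for independent `Z`, `Z'` with the continuous law `ν`. -/
noncomputable def shiftProb (ν : Measure ℝ) (δ : ℝ) : ℝ :=
  1 - ∫ z, cdf ν (z - δ) ∂ν

section ShiftProb

variable (ν : Measure ℝ) [IsProbabilityMeasure ν]

theorem integrable_cdf_sub (δ : ℝ) : Integrable (fun z => cdf ν (z - δ)) ν := by
  refine Integrable.of_bound
    ((monotone_cdf ν).measurable.comp (measurable_sub_const δ)).aestronglyMeasurable 1
    (Eventually.of_forall fun z => ?_)
  rw [Real.norm_eq_abs, abs_of_nonneg (cdf_nonneg ν _)]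
  exact cdf_le_one ν _

theorem measure_Ioc_pos {a b : ℝ} (h : cdf ν a < cdf ν b) : 0 < ν (Set.Ioc a b) := by
  rw [← measure_cdf ν, StieltjesFunction.measure_Ioc]
  exact ENNReal.ofReal_pos.2 (sub_pos.2 h)

/-- Otherwise the distribution function is invariant under steps of `δ / 2`, hence identically `1`,
contradicting its limit at `-∞`. -/
theorem exists_cdf_lt_of_sub_lt (ν : Measure ℝ) {δ : ℝ} (hδ : 0 < δ) :
    ∃ a b, a < b ∧ b - a < δ ∧ cdf ν a < cdf ν b := by
  by_contra! hcon
  have hstep : ∀ x, cdf ν (x + δ / 2) = cdf ν x := fun x =>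
    le_antisymm (hcon x (x + δ / 2) (by linarith) (by linarith))
      (monotone_cdf ν (by linarith))
  have hmul : ∀ n : ℕ, ∀ x, cdf ν (x + n * (δ / 2)) = cdf ν x := by
    intro n
    induction n with
    | zero => simp
    | succ n ih =>
      intro x
      push_cast
      rw [add_mul, one_mul, ← add_assoc, hstep, ih]
  have hone : ∀ x, cdf ν x = 1 := fun x => by
    have h1 : Tendsto (fun n : ℕ => x + n * (δ / 2)) atTop atTop :=
      tendsto_atTop_add_const_left _ _
        (tendsto_natCast_atTop_atTop.atTop_mul_const (half_pos hδ))
    have h2 := (tendsto_cdf_atTop ν).comp h1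
    exact tendsto_nhds_unique (tendsto_const_nhds.congr fun n => (hmul n x).symm) h2
  have h0 := tendsto_cdf_atBot ν
  rw [show (cdf ν : ℝ → ℝ) = fun _ => 1 from funext hone] at h0
  exact one_ne_zero (tendsto_nhds_unique tendsto_const_nhds h0)

/-- Strictness needs positive mass where the shift changes `F`. Take `(a, b]` shorter than `δ` with
`F a < F b`, split at `c` where `F` is midway: from `(c, b]` a shift by `-δ` lands at or below `a`,
from `(a, c]` a shift by `δ` lands at or above `b`. -/
theorem shiftProb_lt (hF : Continuous (cdf ν)) {δ : ℝ} (hδ : 0 < δ) :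
    shiftProb ν 0 < shiftProb ν δ ∧ shiftProb ν (-δ) < shiftProb ν 0 := by
  obtain ⟨a, b, hab, habδ, hFab⟩ := exists_cdf_lt_of_sub_lt ν hδ
  obtain ⟨c, hc, hFc⟩ := intermediate_value_Icc hab.le hF.continuousOn
    (show (cdf ν a + cdf ν b) / 2 ∈ Set.Icc (cdf ν a) (cdf ν b) from
      ⟨by linarith, by linarith⟩)
  have key : ∀ (s t : ℝ), s ≤ t → ∀ S : Set ℝ, 0 < ν S →
      (∀ z ∈ S, cdf ν (z - t) < cdf ν (z - s)) → shiftProb ν s < shiftProb ν t := by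
    intro s t hst S hS hlt
    have h := (integral_pos_iff_support_of_nonneg
      (f := fun z => cdf ν (z - s) - cdf ν (z - t)) (μ := ν)
      (fun z => sub_nonneg.2 (monotone_cdf ν (by linarith)))
      ((integrable_cdf_sub ν s).sub (integrable_cdf_sub ν t))).2
      (hS.trans_le (measure_mono fun z hz => (sub_pos.2 (hlt z hz)).ne'))
    rw [integral_sub (integrable_cdf_sub ν s) (integrable_cdf_sub ν t)] at h
    unfold shiftProb
    linarith
  constructor
  · refine key 0 δ hδ.le (Set.Ioc c b) (measure_Ioc_pos ν (by linarith)) fun z hz => ?_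
    have h1 := monotone_cdf ν (show z - δ ≤ a by linarith [hz.2])
    have h2 := monotone_cdf ν (show c ≤ z - 0 by linarith [hz.1])
    linarith
  · refine key (-δ) 0 (by linarith) (Set.Ioc a c) (measure_Ioc_pos ν (by linarith)) fun z hz => ?_
    have h1 := monotone_cdf ν (show b ≤ z - -δ by linarith [hz.1])
    have h2 := monotone_cdf ν (show z - 0 ≤ c by linarith [hz.2])
    linarith

/-- Both differences have the same sign, so they reinforce each other in `α - β`. -/
theorem exists_shiftProb_gap (hF : Continuous (cdf ν)) {Δ : ℝ} (hΔ : Δ ≠ 0) :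
    ∃ d > 0, (d ≤ shiftProb ν 0 - shiftProb ν Δ ∧ d ≤ shiftProb ν (-Δ) - shiftProb ν 0) ∨
      (d ≤ shiftProb ν Δ - shiftProb ν 0 ∧ d ≤ shiftProb ν 0 - shiftProb ν (-Δ)) := by
  rcases lt_or_gt_of_ne hΔ with h | h
  · obtain ⟨h1, h2⟩ := shiftProb_lt ν hF (neg_pos.2 h)
    rw [neg_neg] at h2
    exact ⟨_, lt_min (sub_pos.2 h2) (sub_pos.2 h1), Or.inl ⟨min_le_left _ _, min_le_right _ _⟩⟩
  · obtain ⟨h1, h2⟩ := shiftProb_lt ν hF h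
    exact ⟨_, lt_min (sub_pos.2 h1) (sub_pos.2 h2), Or.inr ⟨min_le_left _ _, min_le_right _ _⟩⟩

end ShiftProb

/-! ### Deterministic bounds on the uniform event -/

section Deterministic

variable {ν : Measure ℝ} [IsProbabilityMeasure ν] {y : ℕ → ℝ} {n : ℕ} {E : ℝ}

/-- Exchanging sum and integral turns the left sum into `∫ #{h ≤ t : z - δ ≤ y h} dν(z)`, whose
integrand is within `E` of `t * (1 - F(z - δ))` for every `z`. -/
theorem abs_sum_cdf_sub_le (hF : Continuous (cdf ν))
    (H : ∀ t ≤ n, ∀ x, |countLE y t x - t * cdf ν x| ≤ E) {t : ℕ} (ht : t ≤ n) (δ : ℝ) :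
    |∑ h ∈ Finset.Icc 1 t, cdf ν (y h + δ) - t * shiftProb ν δ| ≤ E := by
  set m : ℝ → ℝ := fun w => ∑ h ∈ Finset.Icc 1 t, if w ≤ y h then (1 : ℝ) else 0 with hm
  have hadd : ∀ w, m w + ∑ h ∈ Finset.Icc 1 t, (if y h < w then (1 : ℝ) else 0) = t := by
    intro w
    rw [hm, ← Finset.sum_add_distrib]
    calc _ = ∑ h ∈ Finset.Icc 1 t, (1 : ℝ) := Finset.sum_congr rfl fun h _ => by
          by_cases hw : w ≤ y h
          · simp [hw, not_lt.2 hw]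
          · simp [hw, not_le.1 hw]
      _ = t := by simp
  have hbound : ∀ w, |m w - t * (1 - cdf ν w)| ≤ E := by
    intro w
    have hle : ∑ h ∈ Finset.Icc 1 t, (if y h < w then (1 : ℝ) else 0) ≤ countLE y t w := by
      refine Finset.sum_le_sum fun h _ => ?_
      by_cases hw : y h < w
      · simp [hw, hw.le]
      · rw [if_neg hw]
        split_ifs <;> simp
    -- Strict counts are controlled from below by levels `w' < w`; continuity of `F` lets `w'` tend
    -- to `w` without loss.
    have hge : t * cdf ν w - E ≤ ∑ h ∈ Finset.Icc 1 t, (if y h < w then (1 : ℝ) else 0) := by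
      have hlim : Tendsto (fun w' => t * cdf ν w' - E) (𝓝[<] w) (𝓝 (t * cdf ν w - E)) :=
        ((hF.tendsto w).mono_left nhdsWithin_le_nhds |>.const_mul _).sub_const _
      refine le_of_tendsto hlim ?_
      filter_upwards [self_mem_nhdsWithin] with w' hw'
      have h1 := (abs_le.1 (H t ht w')).1
      have h2 : countLE y t w' ≤ ∑ h ∈ Finset.Icc 1 t, (if y h < w then (1 : ℝ) else 0) := by
        refine Finset.sum_le_sum fun h _ => ?_
        by_cases hw : y h ≤ w'
        · rw [if_pos hw, if_pos (lt_of_le_of_lt hw hw')]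
        · rw [if_neg hw]
          split_ifs <;> simp
      linarith
    have h1 := (abs_le.1 (H t ht w)).2
    rw [abs_le]
    constructor <;> linarith [hadd w]
  have hind : ∀ h, Integrable (fun z => if z - δ ≤ y h then (1 : ℝ) else 0) ν := fun h =>
    Integrable.of_bound (Measurable.ite (measurableSet_le (measurable_sub_const δ)
      measurable_const) measurable_const measurable_const).aestronglyMeasurable 1
      (Eventually.of_forall fun z => by split_ifs <;> simp)
  have hcdf : ∀ h, cdf ν (y h + δ) = ∫ z, (if z - δ ≤ y h then (1 : ℝ) else 0) ∂ν := by
    intro h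
    rw [cdf_eq_real, ← integral_indicator_one measurableSet_Iic]
    refine integral_congr_ae (Eventually.of_forall fun z => ?_)
    simp [Set.indicator_apply]
  have hsum : ∑ h ∈ Finset.Icc 1 t, cdf ν (y h + δ) = ∫ z, m (z - δ) ∂ν := by
    rw [Finset.sum_congr rfl fun h _ => hcdf h, ← integral_finsetSum _ fun h _ => hind h]
  have hmi : Integrable (fun z => m (z - δ)) ν := integrable_finsetSum _ fun h _ => hind h
  have hc : t * shiftProb ν δ = ∫ z, t * (1 - cdf ν (z - δ)) ∂ν := by
    rw [integral_const_mul, integral_sub (integrable_const _) (integrable_cdf_sub ν δ)]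
    simp [shiftProb]
  have hci : Integrable (fun z => t * (1 - cdf ν (z - δ))) ν :=
    ((integrable_const _).sub (integrable_cdf_sub ν δ)).const_mul _
  rw [hsum, hc, ← integral_sub hmi hci]
  have := norm_integral_le_of_norm_le_const (μ := ν)
    (f := fun z => m (z - δ) - t * (1 - cdf ν (z - δ))) (C := E)
    (Eventually.of_forall fun z => hbound _)
  simpa using this

theorem sum_Icc_one_add_sum_Icc (f : ℕ → ℝ) {k n : ℕ} (hk : k ≤ n) :
    ∑ i ∈ Finset.Icc 1 k, f i + ∑ i ∈ Finset.Icc (k + 1) n, f i = ∑ i ∈ Finset.Icc 1 n, f i := by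
  have h : ∀ a b : ℕ, Finset.Icc (a + 1) b = Finset.Ioc a b := fun a b => by
    ext; simp
  have h1 := h 0
  rw [zero_add] at h1
  rw [h1, h1, h]
  exact Finset.sum_Ioc_consecutive f (Nat.zero_le _) hk

namespace SelfNormWilcoxon

/-- The level shift model for a fixed realisation of the noise. -/
structure IsShifted (x y : ℕ → ℝ) (k : ℕ) (μ Δ : ℝ) : Prop where
  left : ∀ i ≤ k, x i = μ + y i
  right : ∀ i, k < i → x i = μ + Δ + y i

variable {x : ℕ → ℝ} {k : ℕ} {μ Δ : ℝ}

theorem IsShifted.rankStat_eq (hx : IsShifted x y k μ Δ) (hk : k ≤ n) {h : ℕ} {o : ℝ}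
    (ho : x h = μ + o + y h) :
    rankStat x n h = countLE y k (y h + o) + (countLE y n (y h + o - Δ)
      - countLE y k (y h + o - Δ)) := by
  have h2 : countLE y n (y h + o - Δ) - countLE y k (y h + o - Δ) =
      ∑ i ∈ Finset.Icc (k + 1) n, if y i ≤ y h + o - Δ then (1 : ℝ) else 0 := by
    unfold countLE
    rw [← sum_Icc_one_add_sum_Icc _ hk]
    ring
  rw [h2, rankStat, ← sum_Icc_one_add_sum_Icc _ hk, countLE]
  congr 1
  · refine Finset.sum_congr rfl fun i hi => ?_
    rw [hx.left i (Finset.mem_Icc.1 hi).2, ho]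
    refine if_congr ⟨fun _ => by linarith, fun _ => by linarith⟩ rfl rfl
  · refine Finset.sum_congr rfl fun i hi => ?_
    rw [hx.right i (Finset.mem_Icc.1 hi).1, ho]
    refine if_congr ⟨fun _ => by linarith, fun _ => by linarith⟩ rfl rfl

theorem IsShifted.abs_rankStat_sub_le {ν : Measure ℝ} (hx : IsShifted x y k μ Δ) (hk : k ≤ n)
    (H : ∀ t ≤ n, ∀ x, |countLE y t x - t * cdf ν x| ≤ E) {h : ℕ} {o : ℝ}
    (ho : x h = μ + o + y h) :
    |rankStat x n h - (k * cdf ν (y h + o) + (n - k) * cdf ν (y h + (o - Δ)))| ≤ 3 * E := by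
  rw [hx.rankStat_eq hk ho, ← add_sub_assoc (y h)]
  have h1 := abs_le.1 (H k hk (y h + o))
  have h2 := abs_le.1 (H n le_rfl (y h + o - Δ))
  have h3 := abs_le.1 (H k hk (y h + o - Δ))
  rw [abs_le]
  constructor <;> linarith [h1.1, h1.2, h2.1, h2.2, h3.1, h3.2]

/-- Each rank is within `3 * E` of a function of `y h` alone; summing these functions costs a
further `E` with total weight `k + (n - k) = n`. -/
theorem IsShifted.abs_sum_rankStat_left_sub_le (hx : IsShifted x y k μ Δ) (hk : k ≤ n)
    (hF : Continuous (cdf ν)) (H : ∀ t ≤ n, ∀ x, |countLE y t x - t * cdf ν x| ≤ E)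
    {t : ℕ} (ht : t ≤ k) :
    |∑ h ∈ Finset.Icc 1 t, rankStat x n h
      - t * (k * shiftProb ν 0 + (n - k) * shiftProb ν (-Δ))| ≤ 4 * n * E := by
  have hE : 0 ≤ E := (abs_nonneg _).trans (H 0 (Nat.zero_le _) 0)
  have hkn : (k : ℝ) ≤ n := by exact_mod_cast hk
  have htn : (t : ℝ) ≤ n := by exact_mod_cast ht.trans hk
  have h1 : |∑ h ∈ Finset.Icc 1 t, (rankStat x n h
      - (k * cdf ν (y h + 0) + (n - k) * cdf ν (y h + (0 - Δ))))| ≤ t * (3 * E) := by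
    refine (Finset.abs_sum_le_sum_abs _ _).trans ((Finset.sum_le_sum fun h hh =>
      hx.abs_rankStat_sub_le hk H (o := 0) ?_).trans (by simp))
    rw [hx.left h ((Finset.mem_Icc.1 hh).2.trans ht), add_zero]
  rw [Finset.sum_sub_distrib, Finset.sum_add_distrib, ← Finset.mul_sum, ← Finset.mul_sum,
    zero_sub] at h1
  have h2 := abs_le.1 (abs_sum_cdf_sub_le hF H (ht.trans hk) 0)
  have h3 := abs_le.1 (abs_sum_cdf_sub_le hF H (ht.trans hk) (-Δ))
  have hk0 : (0 : ℝ) ≤ k := Nat.cast_nonneg k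
  have hnk : (0 : ℝ) ≤ n - k := sub_nonneg.2 hkn
  have h4 := mul_le_mul_of_nonneg_left h2.1 hk0
  have h5 := mul_le_mul_of_nonneg_left h2.2 hk0
  have h6 := mul_le_mul_of_nonneg_left h3.1 hnk
  have h7 := mul_le_mul_of_nonneg_left h3.2 hnk
  have h8 := mul_le_mul_of_nonneg_right htn hE
  rw [abs_le] at h1 ⊢
  constructor <;> linarith [h1.1, h1.2]

theorem IsShifted.abs_sum_rankStat_right_sub_le (hx : IsShifted x y k μ Δ)
    (hF : Continuous (cdf ν)) (H : ∀ t ≤ n, ∀ x, |countLE y t x - t * cdf ν x| ≤ E)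
    {t : ℕ} (hkt : k ≤ t) (ht : t ≤ n) :
    |∑ h ∈ Finset.Icc (k + 1) t, rankStat x n h
      - (t - k) * (k * shiftProb ν Δ + (n - k) * shiftProb ν 0)| ≤ 5 * n * E := by
  have hE : 0 ≤ E := (abs_nonneg _).trans (H 0 (Nat.zero_le _) 0)
  have hk := hkt.trans ht
  have hkn : (k : ℝ) ≤ n := by exact_mod_cast hk
  have hkt' : (k : ℝ) ≤ t := by exact_mod_cast hkt
  have htn : (t : ℝ) ≤ n := by exact_mod_cast ht
  have h1 : |∑ h ∈ Finset.Icc (k + 1) t, (rankStat x n h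
      - (k * cdf ν (y h + Δ) + (n - k) * cdf ν (y h + (Δ - Δ))))| ≤ (t - k) * (3 * E) := by
    refine (Finset.abs_sum_le_sum_abs _ _).trans ((Finset.sum_le_sum fun h hh =>
      hx.abs_rankStat_sub_le hk H (o := Δ) ?_).trans (by simp [Nat.cast_sub hkt]))
    exact hx.right h (Finset.mem_Icc.1 hh).1
  rw [Finset.sum_sub_distrib, Finset.sum_add_distrib, ← Finset.mul_sum, ← Finset.mul_sum,
    sub_self] at h1
  have hsplit : ∀ δ, |∑ h ∈ Finset.Icc (k + 1) t, cdf ν (y h + δ) - (t - k) * shiftProb ν δ|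
      ≤ 2 * E := by
    intro δ
    have e1 := abs_le.1 (abs_sum_cdf_sub_le hF H ht δ)
    have e2 := abs_le.1 (abs_sum_cdf_sub_le hF H hk δ)
    rw [← sum_Icc_one_add_sum_Icc _ hkt] at e1
    rw [abs_le]
    constructor <;> linarith [e1.1, e1.2, e2.1, e2.2]
  have h2 := abs_le.1 (hsplit Δ)
  have h3 := abs_le.1 (hsplit 0)
  have hk0 : (0 : ℝ) ≤ k := Nat.cast_nonneg k
  have hnk : (0 : ℝ) ≤ n - k := sub_nonneg.2 hkn
  have h4 := mul_le_mul_of_nonneg_left h2.1 hk0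
  have h5 := mul_le_mul_of_nonneg_left h2.2 hk0
  have h6 := mul_le_mul_of_nonneg_left h3.1 hnk
  have h7 := mul_le_mul_of_nonneg_left h3.2 hnk
  have h8 := mul_le_mul_of_nonneg_right (show (t : ℝ) - k ≤ n by linarith) hE
  rw [abs_le] at h1 ⊢
  constructor <;> linarith [h1.1, h1.2]

/-- Centring cancels `α`: the partial sum is the error at `t` minus a fraction, at most `1`, of the
error at `k`. -/
theorem abs_partialSum_le {j k t : ℕ} (hjt : j ≤ t) (htk : t ≤ k) {α C : ℝ}
    (h : ∀ s, j ≤ s → s ≤ k →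
      |∑ i ∈ Finset.Icc j s, rankStat x n i - (s - j + 1) * α| ≤ C) :
    |partialSum x n j k t| ≤ 2 * C := by
  have hjt' : (j : ℝ) ≤ t := by exact_mod_cast hjt
  have htk' : (t : ℝ) ≤ k := by exact_mod_cast htk
  have hpos : (0 : ℝ) < k - j + 1 := by linarith
  have hC : 0 ≤ C := (abs_nonneg _).trans (h t hjt htk)
  have h1 := h t hjt htk
  have h2 := h k (hjt.trans htk) le_rfl
  have heq : partialSum x n j k t = (∑ i ∈ Finset.Icc j t, rankStat x n i - (t - j + 1) * α)
      - ((t - j + 1) / (k - j + 1)) *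
        (∑ i ∈ Finset.Icc j k, rankStat x n i - (k - j + 1) * α) := by
    rw [partialSum, Finset.sum_sub_distrib, Finset.sum_const, Nat.card_Icc, nsmul_eq_mul,
      Nat.cast_sub (by omega), meanRank]
    push_cast
    field_simp
    ring
  have hq : |(t - j + 1 : ℝ) / (k - j + 1)| ≤ 1 := by
    rw [abs_of_nonneg (div_nonneg (by linarith) hpos.le), div_le_one hpos]
    linarith
  rw [heq]
  refine (abs_sub _ _).trans ?_
  rw [abs_mul]
  have h3 := mul_le_of_le_one_left (abs_nonneg (∑ i ∈ Finset.Icc j k, rankStat x n i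
    - (k - j + 1) * α)) hq
  linarith

theorem selfNormalizer_le (hk : k ≤ n) (hn : 0 < n) {C : ℝ} (hC : 0 ≤ C)
    (h1 : ∀ t, 1 ≤ t → t ≤ k → |partialSum x n 1 k t| ≤ C)
    (h2 : ∀ t, k + 1 ≤ t → t ≤ n → |partialSum x n (k + 1) n t| ≤ C) :
    selfNormalizer x n k ≤ C := by
  have hn' : (0 : ℝ) < n := by exact_mod_cast hn
  refine Real.sqrt_le_iff.2 ⟨hC, ?_⟩
  have e1 : ∑ t ∈ Finset.Icc 1 k, partialSum x n 1 k t ^ 2 ≤ k * C ^ 2 := by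
    refine (Finset.sum_le_sum fun t ht => sq_le_sq' (abs_le.1 (h1 t (Finset.mem_Icc.1 ht).1
      (Finset.mem_Icc.1 ht).2)).1 (abs_le.1 (h1 t (Finset.mem_Icc.1 ht).1
      (Finset.mem_Icc.1 ht).2)).2).trans (by simp)
  have e2 : ∑ t ∈ Finset.Icc (k + 1) n, partialSum x n (k + 1) n t ^ 2 ≤ (n - k) * C ^ 2 := by
    refine (Finset.sum_le_sum fun t ht => sq_le_sq' (abs_le.1 (h2 t (Finset.mem_Icc.1 ht).1
      (Finset.mem_Icc.1 ht).2)).1 (abs_le.1 (h2 t (Finset.mem_Icc.1 ht).1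
      (Finset.mem_Icc.1 ht).2)).2).trans (by simp [Nat.cast_sub hk])
  rw [← mul_add, one_div, inv_mul_le_iff₀ hn']
  linarith

theorem rankStat_lt {a b : ℕ} (hb : b ∈ Finset.Icc 1 n) (hab : x a < x b) :
    rankStat x n a < rankStat x n b := by
  refine Finset.sum_lt_sum (fun j _ => ?_) ⟨b, hb, ?_⟩
  · by_cases h : x j ≤ x a
    · rw [if_pos h, if_pos (h.trans hab.le)]
    · rw [if_neg h]
      split_ifs <;> simp
  · rw [if_neg (not_le.2 hab), if_pos le_rfl]
    exact one_pos

/-- If all partial sums vanish, so do their increments, and the ranks are constant on the segment;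
ranks strictly separate distinct values. -/
theorem eq_of_selfNormalizer_eq_zero (hk : k ≤ n) (h0 : selfNormalizer x n k = 0)
    {a : ℕ} (ha : a ∈ Finset.Icc 1 k) {b : ℕ} (hb : b ∈ Finset.Icc 1 k) : x a = x b := by
  have hnn : (0 : ℝ) ≤ 1 / n := by positivity
  have hs1 : 0 ≤ ∑ t ∈ Finset.Icc 1 k, partialSum x n 1 k t ^ 2 :=
    Finset.sum_nonneg fun _ _ => sq_nonneg _
  have hs2 : 0 ≤ ∑ t ∈ Finset.Icc (k + 1) n, partialSum x n (k + 1) n t ^ 2 :=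
    Finset.sum_nonneg fun _ _ => sq_nonneg _
  have hle := Real.sqrt_eq_zero'.1 h0
  have hn : (0 : ℝ) < 1 / n := by
    have : 0 < n := by have := Finset.mem_Icc.1 ha; omega
    positivity
  have hsum : ∑ t ∈ Finset.Icc 1 k, partialSum x n 1 k t ^ 2 = 0 := by
    have e1 := mul_nonneg hnn hs1
    have e2 := mul_nonneg hnn hs2
    have e3 : (1 / (n : ℝ)) * ∑ t ∈ Finset.Icc 1 k, partialSum x n 1 k t ^ 2 = 0 := by linarith
    exact (mul_eq_zero.1 e3).resolve_left hn.ne'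
  have hz : ∀ t ∈ Finset.Icc 1 k, partialSum x n 1 k t = 0 := fun t ht =>
    pow_eq_zero_iff two_ne_zero |>.1
      ((Finset.sum_eq_zero_iff_of_nonneg fun _ _ => sq_nonneg _).1 hsum t ht)
  have hrank : ∀ t ∈ Finset.Icc 1 k, rankStat x n t = meanRank x n 1 k := by
    intro t ht
    obtain ⟨ht1, htk⟩ := Finset.mem_Icc.1 ht
    obtain ⟨s, rfl⟩ : ∃ s, t = s + 1 := ⟨t - 1, by omega⟩
    have e1 := hz _ ht
    have e2 : partialSum x n 1 k s = 0 := by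
      rcases Nat.eq_zero_or_pos s with rfl | hs
      · simp [partialSum]
      · exact hz s (Finset.mem_Icc.2 ⟨hs, by omega⟩)
    unfold partialSum at e1 e2
    rw [Finset.sum_Icc_succ_top (by omega), e2] at e1
    linarith
  have hsubset := Finset.Icc_subset_Icc_right (a := 1) hk
  have hab := (hrank a ha).trans (hrank b hb).symm
  rcases lt_trichotomy (x a) (x b) with h | h | h
  · exact absurd hab (rankStat_lt (hsubset hb) h).ne
  · exact h
  · exact absurd hab (rankStat_lt (hsubset ha) h).ne'

/-- Needed because a zero denominator would make `statG` zero. A constant first segment would have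
count `0` or `k` at a median of `ν`, a deviation of `k / 2 > E`. -/
theorem IsShifted.selfNormalizer_pos {ν : Measure ℝ} (hx : IsShifted x y k μ Δ) (hk : k ≤ n)
    (hF : Continuous (cdf ν)) (H : ∀ t ≤ n, ∀ x, |countLE y t x - t * cdf ν x| ≤ E)
    (hkE : 2 * E < k) : 0 < selfNormalizer x n k := by
  refine lt_of_le_of_ne (Real.sqrt_nonneg _) fun h0 => ?_
  have hE : 0 ≤ E := (abs_nonneg _).trans (H 0 (Nat.zero_le _) 0)
  have hk0 : 1 ≤ k := by
    have : (0 : ℝ) < k := by linarith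
    exact_mod_cast this
  have h1 : (1 : ℕ) ∈ Finset.Icc 1 k := Finset.mem_Icc.2 ⟨le_rfl, hk0⟩
  have hy : ∀ i ∈ Finset.Icc 1 k, y i = y 1 := fun i hi => by
    have := eq_of_selfNormalizer_eq_zero hk h0.symm hi h1
    rw [hx.left i (Finset.mem_Icc.1 hi).2, hx.left 1 hk0] at this
    linarith
  obtain ⟨w, hw⟩ : ∃ w, cdf ν w = 1 / 2 := mem_range_of_exists_le_of_exists_ge hF
      (((tendsto_cdf_atBot ν).eventually (gt_mem_nhds (by norm_num))).exists.imp fun _ h => h.le)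
      (((tendsto_cdf_atTop ν).eventually (lt_mem_nhds (by norm_num))).exists.imp fun _ h => h.le)
  have hdev := abs_le.1 (H k hk w)
  rw [hw] at hdev
  have hcount : countLE y k w = k * if y 1 ≤ w then (1 : ℝ) else 0 := by
    rw [countLE, Finset.sum_congr rfl fun i hi => by rw [hy i hi]]
    simp
  rw [hcount] at hdev
  split_ifs at hdev <;> linarith [hdev.1, hdev.2]

theorem IsShifted.le_cusumRank (hx : IsShifted x y k μ Δ) (hk : k ≤ n) (hn : 0 < n)
    (hF : Continuous (cdf ν)) (H : ∀ t ≤ n, ∀ x, |countLE y t x - t * cdf ν x| ≤ E) {d : ℝ}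
    (hd : (d ≤ shiftProb ν 0 - shiftProb ν Δ ∧ d ≤ shiftProb ν (-Δ) - shiftProb ν 0) ∨
      (d ≤ shiftProb ν Δ - shiftProb ν 0 ∧ d ≤ shiftProb ν 0 - shiftProb ν (-Δ))) :
    k * (n - k) * d - 9 * n * E ≤ cusumRank x n k := by
  have hE : 0 ≤ E := (abs_nonneg _).trans (H 0 (Nat.zero_le _) 0)
  have hn' : (0 : ℝ) < n := by exact_mod_cast hn
  have hkn : (k : ℝ) ≤ n := by exact_mod_cast hk
  have hk0 : (0 : ℝ) ≤ k := Nat.cast_nonneg k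
  have hnk : (0 : ℝ) ≤ n - k := sub_nonneg.2 hkn
  have hA := hx.abs_sum_rankStat_left_sub_le hk hF H (le_refl k)
  have hB := hx.abs_sum_rankStat_right_sub_le hF H hk le_rfl
  rw [cusumRank, ← sum_Icc_one_add_sum_Icc _ hk]
  set A := ∑ h ∈ Finset.Icc 1 k, rankStat x n h
  set B := ∑ h ∈ Finset.Icc (k + 1) n, rankStat x n h
  set α := k * shiftProb ν 0 + (n - k) * shiftProb ν (-Δ) with hα
  set β := k * shiftProb ν Δ + (n - k) * shiftProb ν 0 with hβ
  -- The numerator is `((n - k) A - k B) / n`; replacing `A` and `B` by their main terms leaves `k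
  -- (n - k) (α - β) / n`.
  have heq : A - k / n * (A + B) = k * (n - k) / n * (α - β)
      + ((n - k) / n * (A - k * α) - k / n * (B - (n - k) * β)) := by
    field_simp
    ring
  have hp : (0 : ℝ) ≤ (n - k) / n := by positivity
  have hq : (0 : ℝ) ≤ k / n := by positivity
  have hp1 : (n - k : ℝ) / n ≤ 1 := (div_le_one hn').2 (by linarith)
  have hq1 : (k : ℝ) / n ≤ 1 := (div_le_one hn').2 hkn
  have herr : |(n - k) / n * (A - k * α) - k / n * (B - (n - k) * β)| ≤ 9 * n * E := by
    refine (abs_sub _ _).trans ?_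
    rw [abs_mul, abs_mul, abs_of_nonneg hp, abs_of_nonneg hq]
    have := mul_le_of_le_one_left (abs_nonneg (A - k * α)) hp1
    have := mul_le_of_le_one_left (abs_nonneg (B - (n - k) * β)) hq1
    linarith
  have hgap : n * d ≤ |α - β| := by
    rcases hd with ⟨h1, h2⟩ | ⟨h1, h2⟩
    · have := mul_le_mul_of_nonneg_left h1 hk0
      have := mul_le_mul_of_nonneg_left h2 hnk
      exact le_trans (by linarith) (le_abs_self _)
    · have := mul_le_mul_of_nonneg_left h1 hk0
      have := mul_le_mul_of_nonneg_left h2 hnk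
      exact le_trans (by linarith) (neg_le_abs _)
  have hmain : k * (n - k) * d ≤ |k * (n - k) / n * (α - β)| := by
    have hpq : (0 : ℝ) ≤ k * (n - k) / n := by positivity
    rw [abs_mul, abs_of_nonneg hpq]
    calc k * (n - k) * d = k * (n - k) / n * (n * d) := by field_simp
      _ ≤ _ := mul_le_mul_of_nonneg_left hgap hpq
  rw [heq]
  have := abs_sub_abs_le_abs_add (k * (n - k) / n * (α - β))
    ((n - k) / n * (A - k * α) - k / n * (B - (n - k) * β))
  linarith

theorem IsShifted.selfNormalizer_le (hx : IsShifted x y k μ Δ) (hk : k ≤ n) (hn : 0 < n)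
    (hF : Continuous (cdf ν)) (H : ∀ t ≤ n, ∀ x, |countLE y t x - t * cdf ν x| ≤ E) :
    selfNormalizer x n k ≤ 10 * n * E := by
  have hE : 0 ≤ E := (abs_nonneg _).trans (H 0 (Nat.zero_le _) 0)
  have hnE : 0 ≤ n * E := by positivity
  refine SelfNormWilcoxon.selfNormalizer_le hk hn (by linarith) (fun t h1 h2 => ?_)
    fun t h1 h2 => ?_
  · refine (abs_partialSum_le (α := k * shiftProb ν 0 + (n - k) * shiftProb ν (-Δ))
      (C := 4 * n * E) h1 h2 fun s _ hs => ?_).trans (by linarith)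
    simpa using hx.abs_sum_rankStat_left_sub_le hk hF H hs
  · refine (abs_partialSum_le (α := k * shiftProb ν Δ + (n - k) * shiftProb ν 0)
      (C := 5 * n * E) h1 h2 fun s hs1 hs2 => ?_).trans (by linarith)
    have := hx.abs_sum_rankStat_right_sub_le hF H (Nat.le_of_succ_le hs1) hs2
    push_cast
    rwa [show (s - (k + 1) + 1 : ℝ) = s - k by ring]

theorem IsShifted.lt_statG (hx : IsShifted x y k μ Δ) (hk : k ≤ n) (hn : 0 < n)
    (hF : Continuous (cdf ν)) {ε : ℝ}
    (H : ∀ t ≤ n, ∀ x, |countLE y t x - t * cdf ν x| ≤ ε * n) {d : ℝ}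
    (hd : (d ≤ shiftProb ν 0 - shiftProb ν Δ ∧ d ≤ shiftProb ν (-Δ) - shiftProb ν 0) ∨
      (d ≤ shiftProb ν Δ - shiftProb ν 0 ∧ d ≤ shiftProb ν 0 - shiftProb ν (-Δ)))
    (hd0 : 0 ≤ d) {κ : ℝ} (hκ : κ * n ^ 2 ≤ k * (n - k)) (hkε : 2 * ε * n < k) {M : ℝ}
    (hM0 : 0 ≤ M) (hM : M * (10 * ε) < κ * d - 9 * ε) : M < statG x n k := by
  have hn' : (0 : ℝ) < n := by exact_mod_cast hn
  have hpos := hx.selfNormalizer_pos hk hF H (by linarith)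
  have hnum := hx.le_cusumRank hk hn hF H hd
  have hden := hx.selfNormalizer_le hk hn hF H
  rw [statG, lt_div_iff₀ hpos]
  have h1 := mul_le_mul_of_nonneg_left hden hM0
  have h2 := mul_le_mul_of_nonneg_right hκ hd0
  have h3 := mul_lt_mul_of_pos_right hM (show (0 : ℝ) < n ^ 2 by positivity)
  linarith [show M * (10 * n * (ε * n)) = M * (10 * ε) * n ^ 2 by ring,
    show (κ * d - 9 * ε) * (n : ℝ) ^ 2 = κ * n ^ 2 * d - 9 * n * (ε * n) by ring]

end SelfNormWilcoxon

end Deterministic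

/-! ### Divergence of the test statistic -/

namespace SelfNormWilcoxon

theorem isShifted_shiftModel {Ω : Type*} (ξ : ℕ → Ω → ℝ) (G : ℝ → ℝ) (μ Δ τ : ℝ) (n : ℕ) (ω : Ω) :
    IsShifted (shiftModel ξ G μ Δ τ n ω) (fun i => G (ξ i ω)) ⌊(n : ℝ) * τ⌋₊ μ Δ where
  left i hi := by rw [shiftModel, if_pos hi]
  right i hi := by rw [shiftModel, if_neg (not_le.2 hi)]

theorem statG_le_statT (x : ℕ → ℝ) (n : ℕ) {τ₁ τ₂ τ : ℝ} (hτ : τ ∈ Set.Icc τ₁ τ₂) :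
    statG x n ⌊(n : ℝ) * τ⌋₊ ≤ statT x n τ₁ τ₂ :=
  le_ciSup (f := fun k : Set.Icc ⌊(n : ℝ) * τ₁⌋₊ ⌊(n : ℝ) * τ₂⌋₊ => statG x n k)
    (Set.finite_range _).bddAbove
    ⟨⌊(n : ℝ) * τ⌋₊, Nat.floor_le_floor (mul_le_mul_of_nonneg_left hτ.1 (Nat.cast_nonneg n)),
      Nat.floor_le_floor (mul_le_mul_of_nonneg_left hτ.2 (Nat.cast_nonneg n))⟩

end SelfNormWilcoxon

theorem theorem2 {Ω : Type*} [MeasurableSpace Ω] (P : Measure Ω) [IsProbabilityMeasure P]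
    (ξ : ℕ → Ω → ℝ) (D : ℝ) (hξ : SelfNormWilcoxon.IsLRDGaussian P ξ D)
    (G : ℝ → ℝ) (hG : Measurable G)
    (hF : Continuous (cdf (P.map (fun ω => G (ξ 1 ω)))))
    (m : ℕ) (hm : SelfNormWilcoxon.IsHermiteRank P (ξ 1) G m)
    (hD0 : 0 < D) (hDm : D < 1 / (m : ℝ))
    (τ₁ τ₂ : ℝ) (hτ₁ : 0 < τ₁) (hτ₁₂ : τ₁ < τ₂) (hτ₂ : τ₂ < 1)
    (τ : ℝ) (hτ : τ ∈ Set.Icc τ₁ τ₂)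
    (μ Δ : ℝ) (hΔ : Δ ≠ 0) :
    ∀ M : ℝ, Tendsto
      (fun n : ℕ => P {ω | M <
        SelfNormWilcoxon.statT (SelfNormWilcoxon.shiftModel ξ G μ Δ τ n ω) n τ₁ τ₂})
      atTop (𝓝 1) := by
  intro M
  have : IsProbabilityMeasure (P.map (fun ω => G (ξ 1 ω))) := Measure.isProbabilityMeasure_map
    (hG.comp_aemeasurable (hξ.hasGaussianLaw le_rfl).aemeasurable)
  have hτ0 : 0 < τ := hτ₁.trans_le hτ.1
  have hτ1 : 0 < 1 - τ := sub_pos.2 (hτ.2.trans_lt hτ₂)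
  obtain ⟨d, hd0, hd⟩ := exists_shiftProb_gap (P.map (fun ω => G (ξ 1 ω))) hF hΔ
  -- For large `n`, `⌊nτ⌋ > nτ / 2` and `n - ⌊nτ⌋ ≥ n (1 - τ)`, so `κ * n ^ 2` bounds `k (n - k)`
  -- from below.
  set κ : ℝ := τ / 2 * (1 - τ) with hκ
  have hκ0 : 0 < κ := by positivity
  -- The first bound gives `2 * ε * n < k` for positivity of the denominator; the second gives `(10
  -- * |M| + 9) * ε ≤ κ * d / 2`.
  set ε : ℝ := min (τ / 4) (κ * d / (2 * (10 * |M| + 9))) with hε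
  have hε0 : 0 < ε := lt_min (by positivity) (by positivity)
  have hετ : ε ≤ τ / 4 := min_le_left _ _
  have hεM : |M| * (10 * ε) < κ * d - 9 * ε := by
    have h1 : ε ≤ κ * d / (2 * (10 * |M| + 9)) := min_le_right _ _
    rw [le_div_iff₀ (by positivity)] at h1
    have h2 : 0 < κ * d := by positivity
    linarith
  have hlim := hξ.tendsto_measure_empirical_deviation hD0 hG hF hε0
  have hlim' := ENNReal.Tendsto.sub (tendsto_const_nhds (x := (1 : ENNReal))) hlim
    (Or.inl ENNReal.one_ne_top)
  rw [tsub_zero] at hlim'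
  refine tendsto_of_tendsto_of_tendsto_of_le_of_le' hlim' tendsto_const_nhds ?_
    (Eventually.of_forall fun n => prob_le_one)
  have hlarge : ∀ᶠ n : ℕ in atTop, 2 / τ ≤ (n : ℝ) :=
    tendsto_natCast_atTop_atTop.eventually (eventually_ge_atTop _)
  filter_upwards [hlarge, eventually_gt_atTop 0] with n hn hn0
  rw [div_le_iff₀ hτ0] at hn
  have hn0' : (0 : ℝ) < n := by exact_mod_cast hn0
  have hfl := Nat.floor_le (show 0 ≤ (n : ℝ) * τ by positivity)
  have hlt : (n : ℝ) * τ / 2 < ⌊(n : ℝ) * τ⌋₊ := by linarith [Nat.lt_floor_add_one ((n : ℝ) * τ)]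
  have hnk : (n : ℝ) * (1 - τ) ≤ n - ⌊(n : ℝ) * τ⌋₊ := by linarith
  have hkn : ⌊(n : ℝ) * τ⌋₊ ≤ n := by
    have h1 : (0 : ℝ) ≤ n * (1 - τ) := by positivity
    have h2 : (⌊(n : ℝ) * τ⌋₊ : ℝ) ≤ n := by linarith
    exact_mod_cast h2
  have hκk : κ * (n : ℝ) ^ 2 ≤ ⌊(n : ℝ) * τ⌋₊ * (n - ⌊(n : ℝ) * τ⌋₊) := by
    calc κ * (n : ℝ) ^ 2 = n * τ / 2 * (n * (1 - τ)) := by rw [hκ]; ring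
      _ ≤ _ := mul_le_mul hlt.le hnk (by positivity) (Nat.cast_nonneg _)
  have hεk : 2 * ε * n < ⌊(n : ℝ) * τ⌋₊ := by
    have := mul_le_mul_of_nonneg_right hετ hn0'.le
    linarith
  -- Covering the whole space by the target event and the exceptional event uses only subadditivity,
  -- so neither has to be measurable.
  rw [tsub_le_iff_right, ← measure_univ (μ := P)]
  refine (measure_mono fun ω _ => ?_).trans (measure_union_le _ _)
  refine or_iff_not_imp_right.2 fun hω => ?_
  have H := not_not.1 hω
  have := (SelfNormWilcoxon.isShifted_shiftModel ξ G μ Δ τ n ω).lt_statG hkn hn0 hF H hd hd0.le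
    hκk hεk (abs_nonneg M) hεM
  exact (le_abs_self M).trans_lt (this.trans_le (SelfNormWilcoxon.statG_le_statT _ n hτ))
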